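/- Let $(B_t)_{t\ge 0}$ be a standard Brownian motion on a probability space, let $n\ge 0$, put $W_0(t)=B_t$, $W_{k}(t)=\int_0^t W_{k-1}(s)\,ds$ for $1\le k\le n$, and $W(t)=(W_0(t),\dots,W_n(t))\in\mathbb R^{n+1}$. For $s\in\mathbb R$ put $X_k(s)=e^{-(k+1/2)s}W_k(e^s)$ and $X(s)=(X_0(s),\dots,X_n(s))$. Rows and columns of matrices are numbered from $0$ to $n$. For $t>0$ define the $(n+1)\times(n+1)$ matrices $$A_{jk}=(-1)^{j+k}\frac{(j+k)!}{k!\,(j-k)!}\ (j\ge k),\quad A_{jk}=0\ (j<k);\qquad \Gamma_{jk}=\frac1{(j-k)!}\ (j\ge k),\quad \Gamma_{jk}=0\ (j<k);$$ $$\mathbf T(t)=\mathrm{diag}\big(t^{-(k+1/2)}\big)_{0\le k\le n},\qquad \Lambda=\mathrm{diag}(2k+1)_{0\le k\le n},\qquad (A^*)_{jk}=(-1)^{j+k}A_{jk},$$ and for a vector $a$ put $(a^*)_j=(-1)^ja_j$. A transition density of $W$ is a nonnegative function $\pi_a(w,t)$ ($a,w\in\mathbb R^{n+1}$, $t>0$),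 measurable in $(a,w)$, with $P(W(s+t)\in dw\mid W(s)=a)=\pi_a(w,t)\,dw$ for all $s\ge0$, $t>0$ and almost every value $a$ of $W(s)$. Then $W$ has exactly one transition density that is continuous in $(a,w)$ for every $t>0$; $W$ is Markov with this density, i.e. the conditional law of $W(s+t)$ given $(W(r))_{r\le s}$ has density $w\mapsto\pi_{W(s)}(w,t)$. For every $s\in\mathbb R$ the vector $X(s)$ has one and the same continuous density $p_n$ on $\mathbb R^{n+1}$, and for all $t>0$ and $a,w\in\mathbb R^{n+1}$ $$\pi_a(w,t)=t^{-\frac12(n+1)^2}\,p_n\big(\mathbf T(t)w-\Gamma\mathbf T(t)a\big) =t^{-\frac12(n+1)^2}K_n\exp\Big(-\tfrac12\,[A\mathbf T(t)w-A^*\mathbf T(t)a]'\,\Lambda\,[A\mathbf T(t)w-A^*\mathbf T(t)a]\Big),$$ $$K_n=\frac1{(2\pi)^{(n+1)/2}}\sqrt{\frac{(2n+1)!}{2^n\,n!}}\ \prod_{m=0}^n\frac{(2m)!}{m!}.$$ Moreover: 1. $\pi_a(w,t)=\pi_{w^*}(a^*,t)$ for all $t>0$ and $a,w\in\mathbb R^{n+1}$.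 2. For all $N$ and $0\le t_0<t_1<\dots<t_N$, the random vectors $W(t_i)-\mathbf B(t_i-t_{i-1})W(t_{i-1})$, $1\le i\le N$, are independent, where $\mathbf B(t)=\mathbf T(t)^{-1}\Gamma\,\mathbf T(t)$. -/

import Mathlib

open MeasureTheory ProbabilityTheory
open scoped NNReal Matrix Nat

namespace IntegratedBrownian

/-- The state space `ℝ^{n+1}`; coordinates are numbered from `0` to `n`. -/
abbrev State (n : ℕ) : Type := Fin (n + 1) → ℝ

noncomputable section

variable {Ω : Type*}

/-- The `k`-fold integrated process `W_k` of a real process `B`, computed pathwise: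
`W_0(t) = B(t)` and `W_{k+1}(t) = ∫_0^t W_k(s) ds`. -/
def integrated (B : ℝ≥0 → Ω → ℝ) : ℕ → ℝ≥0 → Ω → ℝ
  | 0, t, ω => B t ω
  | k + 1, t, ω => ∫ s in (0 : ℝ)..(t : ℝ), integrated B k s.toNNReal ω

/-- The vector process `W(t) = (W_0(t), …, W_n(t))`. -/
def W (B : ℝ≥0 → Ω → ℝ) (n : ℕ) (t : ℝ≥0) (ω : Ω) : State n :=
  fun k => integrated B k t ω

/-- The vector process `X(s) = (X_0(s), …, X_n(s))`, `X_k(s) = e^{-(k+1/2)s} W_k(e^s)`, `s ∈ ℝ`. -/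
def X (B : ℝ≥0 → Ω → ℝ) (n : ℕ) (s : ℝ) (ω : Ω) : State n :=
  fun k => Real.exp (-((k : ℝ) + 1 / 2) * s) * integrated B k (Real.exp s).toNNReal ω

/-- The measure on `ℝ^{n+1}` with density `f` with respect to Lebesgue measure. -/
def withLebesgueDensity {n : ℕ} (f : State n → ℝ) : Measure (State n) :=
  volume.withDensity fun w => ENNReal.ofReal (f w)

/-- `π t a w = π_a(w,t)` is a transition density of the process `Y`:
`P(Y(s+t) ∈ dw | Y(s) = a) = π_a(w,t) dw` for all `s ≥ 0`, `t > 0` and almost every value `a`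
of `Y(s)`. -/
structure IsTransitionDensity [MeasurableSpace Ω] {n : ℕ} (Y : ℝ≥0 → Ω → State n)
    (P : Measure Ω) [IsFiniteMeasure P] (π : ℝ≥0 → State n → State n → ℝ) : Prop where
  aemeasurable : ∀ t, AEMeasurable (Y t) P
  measurable : ∀ t, 0 < t → Measurable fun q : State n × State n => π t q.1 q.2
  nonneg : ∀ t, 0 < t → ∀ a w, 0 ≤ π t a w
  condDistrib_eq : ∀ s t, 0 < t →
    ∀ᵐ a ∂(P.map (Y s)), condDistrib (Y (s + t)) (Y s) P a = withLebesgueDensity (π t a)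

/-- The path of `Y` up to time `s`. -/
def past {n : ℕ} (Y : ℝ≥0 → Ω → State n) (s : ℝ≥0) (ω : Ω) : Set.Iic s → State n :=
  fun r => Y r ω

/-- `Y` is a Markov process with transition density `π`: the conditional law of `Y(s+t)` given the
whole past `(Y(r), r ≤ s)` has density `w ↦ π_{Y(s)}(w,t)`. -/
structure IsMarkovWithDensity [MeasurableSpace Ω] {n : ℕ} (Y : ℝ≥0 → Ω → State n)
    (P : Measure Ω) [IsFiniteMeasure P] (π : ℝ≥0 → State n → State n → ℝ) : Prop where
  aemeasurable : ∀ s, AEMeasurable (past Y s) P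
  condDistrib_eq : ∀ s t, 0 < t →
    ∀ᵐ y ∂(P.map (past Y s)), condDistrib (Y (s + t)) (past Y s) P y =
      withLebesgueDensity (π t (y ⟨s, le_refl s⟩))

/-- `A_{jk} = (-1)^{j+k} (j+k)! / (k! (j-k)!)` for `j ≥ k`, and `0` otherwise. -/
def A (n : ℕ) : Matrix (Fin (n + 1)) (Fin (n + 1)) ℝ :=
  Matrix.of fun j k =>
    if k ≤ j then
      (-1 : ℝ) ^ ((j : ℕ) + (k : ℕ)) * (((j : ℕ) + (k : ℕ))! : ℝ) /
        (((k : ℕ)! : ℝ) * (((j : ℕ) - (k : ℕ))! : ℝ))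
    else 0

/-- `(M*)_{jk} = (-1)^{j+k} M_{jk}`. -/
def starMat {n : ℕ} (M : Matrix (Fin (n + 1)) (Fin (n + 1)) ℝ) :
    Matrix (Fin (n + 1)) (Fin (n + 1)) ℝ :=
  Matrix.of fun j k => (-1 : ℝ) ^ ((j : ℕ) + (k : ℕ)) * M j k

/-- The same operation on column vectors: `(a*)_j = (-1)^j a_j`. -/
def starVec {n : ℕ} (a : State n) : State n := fun j => (-1 : ℝ) ^ (j : ℕ) * a j

/-- `Γ_{jk} = 1 / (j-k)!` for `j ≥ k`, and `0` otherwise. -/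
def Γ (n : ℕ) : Matrix (Fin (n + 1)) (Fin (n + 1)) ℝ :=
  Matrix.of fun j k => if k ≤ j then 1 / (((j : ℕ) - (k : ℕ))! : ℝ) else 0

/-- The diagonal matrix with entries `Λ_{kk} = 2k+1`. -/
def Λ (n : ℕ) : Matrix (Fin (n + 1)) (Fin (n + 1)) ℝ :=
  Matrix.diagonal fun k => 2 * (k : ℝ) + 1

/-- The diagonal matrix with entries `T(t)_{kk} = t^{-(k+1/2)}`. -/
def T (n : ℕ) (t : ℝ) : Matrix (Fin (n + 1)) (Fin (n + 1)) ℝ :=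
  Matrix.diagonal fun k => t ^ (-((k : ℝ) + 1 / 2))

/-- `B(t) = T(t)⁻¹ Γ T(t)`. -/
def drift (n : ℕ) (t : ℝ) : Matrix (Fin (n + 1)) (Fin (n + 1)) ℝ :=
  (T n t)⁻¹ * Γ n * T n t

/-- `K_n = (2π)^{-(n+1)/2} √((2n+1)! / (2^n n!)) ∏_{m=0}^n (2m)!/m!`. -/
def K (n : ℕ) : ℝ :=
  1 / (2 * Real.pi) ^ (((n : ℝ) + 1) / 2) *
    Real.sqrt (((2 * n + 1)! : ℝ) / ((2 : ℝ) ^ n * (n ! : ℝ))) *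
    ∏ m ∈ Finset.range (n + 1), (((2 * m)! : ℝ) / (m ! : ℝ))

/-- The vector `A T(t) w - A* T(t) a`. -/
def residual (n : ℕ) (t : ℝ) (a w : State n) : State n :=
  (A n * T n t) *ᵥ w - (starMat (A n) * T n t) *ᵥ a

end

end IntegratedBrownian

/-! By Cauchy's formula for repeated integrals and an integration by parts, `c ⬝ᵥ W(t)` is the
Wiener integral over `[0, t]` of `s ↦ c ⬝ᵥ v(t - s)`, where `v(x) = (x^k / k!)_k` is `taylorVec`. So
`W(t)` is a centred Gaussian vector whose covariance is the Gram matrix of the monomials `x^k / k!`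
on `[0, t]` (`integral_exp_dotProduct_W`). The matrix `T(t)` rescales `[0, t]` to `[0, 1]`, and `A
v(x)` lists, up to sign, the shifted Legendre polynomials, which are orthogonal on `[0, 1]` with
squared norms `1 / (2j + 1)`. Hence `Λ^{1/2} A T(t) W(t)` is a standard Gaussian vector
(`hasLaw_whitening_W`). This gives the density of `T(t) W(t)`, the same for all `t > 0`, and `K_n`
is `(2π)^{-(n+1)/2} det(Λ^{1/2} A)`.

Splitting the path at time `s` gives `W(s + t) = B(t) W(s) + V(t)`, where `B(t)` is `drift` and `V`
is built like `W` from the Brownian motion restarted at `s`, independent of the past (`W_add`,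
`indep_shift_W`). An affine change of variables then gives the transition density and the Markov
property, and the modified increments, being such `V`, are independent.

The form with `A*` is the identity `A Γ = A*` (`A_mul_Γ`): `Γ` translates the argument of `v` by
`1`, and `x ↦ 1 - x` multiplies the Legendre polynomial of degree `j` by `(-1)^j`. The symmetry
follows, because exchanging `(a, w)` for `(w*, a*)` only changes signs of the components of the
residual. Uniqueness holds because the law of `W(1)` has a positive density, so an almost sure
equality of continuous densities is an equality everywhere. -/

namespace IntegratedBrownian

/-! ### Integration by parts and Beta integrals on `[0, 1]`. -/

open Polynomial in
/-- Repeated integration by parts for polynomials on `[0, 1]`, without boundary terms. -/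
lemma integral_iterate_derivative_mul (u : ℝ[X]) (j : ℕ)
    (h0 : ∀ i < j, (derivative^[i] u).eval 0 = 0) (h1 : ∀ i < j, (derivative^[i] u).eval 1 = 0)
    (q : ℝ[X]) :
    ∫ x in (0 : ℝ)..1, (derivative^[j] u).eval x * q.eval x =
      (-1) ^ j * ∫ x in (0 : ℝ)..1, u.eval x * (derivative^[j] q).eval x := by
  induction j generalizing q with
  | zero => simp
  | succ j ih =>
    have key := intervalIntegral.integral_mul_deriv_eq_deriv_mul (a := 0) (b := 1)
      (u := fun x => q.eval x) (v := fun x => (derivative^[j] u).eval x)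
      (u' := fun x => (derivative q).eval x) (v' := fun x => (derivative^[j + 1] u).eval x)
      (fun x _ => q.hasDerivAt x)
      (fun x _ => by
        rw [Function.iterate_succ_apply']
        exact (derivative^[j] u).hasDerivAt x)
      ((Polynomial.continuous _).intervalIntegrable _ _)
      ((Polynomial.continuous _).intervalIntegrable _ _)
    simp only [h0 j (Nat.lt_succ_self j), h1 j (Nat.lt_succ_self j), mul_zero, sub_zero,
      zero_sub] at key
    simp_rw [mul_comm ((derivative^[j + 1] u).eval _), key, mul_comm ((derivative q).eval _)]
    rw [ih (fun i hi => h0 i (hi.trans (Nat.lt_succ_self j)))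
      (fun i hi => h1 i (hi.trans (Nat.lt_succ_self j))) (derivative q)]
    rw [← Function.iterate_succ_apply derivative j q, pow_succ]
    ring

/-- Each integration by parts trades a factor `1 - x` for a factor `x`, so the induction on `b` must
leave `a` free. -/
lemma integral_pow_mul_one_sub_pow (a b : ℕ) :
    ∫ x in (0 : ℝ)..1, x ^ a * (1 - x) ^ b = (a ! * b ! : ℝ) / (a + b + 1)! := by
  induction b generalizing a with
  | zero =>
    simp only [pow_zero, mul_one, integral_pow, Nat.factorial]
    push_cast
    field_simp
    simp
  | succ b ih =>
    have key := intervalIntegral.integral_mul_deriv_eq_deriv_mul (a := 0) (b := 1)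
      (u := fun x : ℝ => (1 - x) ^ (b + 1)) (v := fun x => x ^ (a + 1) / (a + 1))
      (u' := fun x => -((b + 1) * (1 - x) ^ b)) (v' := fun x => x ^ a)
      (fun x _ => by simpa using! ((hasDerivAt_id x).const_sub 1).pow (b + 1))
      (fun x _ => by
        have := (hasDerivAt_pow (a + 1) x).div_const ((a : ℝ) + 1)
        convert this using 1
        push_cast
        field_simp)
      ((by fun_prop : Continuous _).intervalIntegrable _ _)
      ((by fun_prop : Continuous _).intervalIntegrable _ _)
    simp_rw [mul_comm (_ ^ a) (_ : ℝ), key]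
    have h2 : ∀ x : ℝ, -((b + 1) * (1 - x) ^ b) * (x ^ (a + 1) / (a + 1)) =
        -((b + 1) / (a + 1)) * (x ^ (a + 1) * (1 - x) ^ b) := fun x => by ring
    simp_rw [h2]
    rw [intervalIntegral.integral_const_mul, ih (a + 1)]
    rw [show a + 1 + b + 1 = a + (b + 1) + 1 by ring]
    simp only [Nat.factorial_succ a, Nat.factorial_succ b]
    push_cast
    field_simp
    simp

/-! ### Orthogonality of the shifted Legendre polynomials. -/

section Legendre

open Polynomial

/-- The shifted Legendre polynomial with real coefficients. -/
noncomputable def legendre (j : ℕ) : ℝ[X] := (shiftedLegendre j).map (Int.castRingHom ℝ)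

lemma coeff_legendre (j k : ℕ) :
    (legendre j).coeff k = (-1) ^ k * j.choose k * (j + k).choose j := by
  simp [legendre, coeff_map, coeff_shiftedLegendre]

lemma natDegree_legendre_le (j : ℕ) : (legendre j).natDegree ≤ j :=
  natDegree_map_le.trans (natDegree_shiftedLegendre j).le

lemma legendre_eval_symm (j : ℕ) (x : ℝ) :
    (legendre j).eval x = (-1) ^ j * (legendre j).eval (1 - x) := by
  have := shiftedLegendre_eval_symm j x
  simpa [legendre, aeval_def, eval_map] using this

lemma factorial_mul_legendre (j : ℕ) :
    (j ! : ℝ[X]) * legendre j = derivative^[j] (Polynomial.X ^ j * (1 - Polynomial.X) ^ j) := by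
  have := congrArg (Polynomial.map (Int.castRingHom ℝ)) (factorial_mul_shiftedLegendre_eq j)
  rw [← iterate_derivative_map] at this
  simpa [legendre, Polynomial.map_mul] using this

/-- Rodrigues' formula followed by `j` integrations by parts; `x^j (1 - x)^j` vanishes to order `j`
at both ends, so no boundary terms appear. -/
lemma integral_legendre_mul (j : ℕ) (q : ℝ[X]) :
    (j ! : ℝ) * ∫ x in (0 : ℝ)..1, (legendre j).eval x * q.eval x =
      (-1) ^ j * ∫ x in (0 : ℝ)..1, x ^ j * (1 - x) ^ j * (derivative^[j] q).eval x := by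
  have h := integral_iterate_derivative_mul (Polynomial.X ^ j * (1 - Polynomial.X) ^ j) j ?_ ?_ q
  · rw [← intervalIntegral.integral_const_mul]
    rw [← factorial_mul_legendre] at h
    simpa [mul_assoc] using h
  · intro i hi
    obtain ⟨r, hr⟩ := pow_sub_dvd_iterate_derivative_of_pow_dvd
      (p := Polynomial.X ^ j * (1 - Polynomial.X : ℝ[X]) ^ j) (q := Polynomial.X)
      (n := j) i (Dvd.intro _ rfl)
    rw [hr]
    simp [Nat.sub_ne_zero_of_lt hi]
  · intro i hi
    obtain ⟨r, hr⟩ := pow_sub_dvd_iterate_derivative_of_pow_dvd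
      (p := Polynomial.X ^ j * (1 - Polynomial.X : ℝ[X]) ^ j) (q := 1 - Polynomial.X)
      (n := j) i (Dvd.intro_left _ rfl)
    rw [hr]
    simp [Nat.sub_ne_zero_of_lt hi]

lemma integral_legendre_mul_legendre_of_lt {j l : ℕ} (h : l < j) :
    ∫ x in (0 : ℝ)..1, (legendre j).eval x * (legendre l).eval x = 0 := by
  have := integral_legendre_mul j (legendre l)
  rw [iterate_derivative_eq_zero ((natDegree_legendre_le l).trans_lt h)] at this
  have hj : (j ! : ℝ) ≠ 0 := by positivity
  simpa [hj] using this

lemma integral_legendre_sq (j : ℕ) :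
    ∫ x in (0 : ℝ)..1, (legendre j).eval x * (legendre j).eval x = 1 / (2 * j + 1) := by
  have h := integral_legendre_mul j (legendre j)
  -- Only the leading coefficient `(-1)^j (2j choose j)` survives `j` derivatives, and it is
  -- multiplied by `j!`.
  have hd : derivative^[j] (legendre j) = C ((-1) ^ j * ((2 * j)! : ℝ) / (j ! : ℝ)) := by
    ext k
    rw [coeff_iterate_derivative, coeff_C]
    rcases Nat.eq_zero_or_pos k with rfl | hk
    · rw [zero_add, Nat.descFactorial_self, coeff_legendre, Nat.choose_self,
        Nat.cast_add_choose ℝ, two_mul]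
      simp
      field_simp
    · rw [coeff_legendre, Nat.choose_eq_zero_of_lt (by omega : j < k + j)]
      simp [hk.ne']
  rw [hd] at h
  simp only [eval_C] at h
  rw [intervalIntegral.integral_mul_const, integral_pow_mul_one_sub_pow] at h
  have hj : (j ! : ℝ) ≠ 0 := by positivity
  apply mul_left_cancel₀ hj
  rw [h, show j + j + 1 = 2 * j + 1 by ring, Nat.factorial_succ]
  have h1 : ((-1 : ℝ) ^ j) * (-1) ^ j = 1 := by rw [← mul_pow]; simp
  push_cast
  field_simp
  linear_combination h1

lemma integral_legendre_mul_legendre (j l : ℕ) :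
    ∫ x in (0 : ℝ)..1, (legendre j).eval x * (legendre l).eval x =
      if j = l then 1 / (2 * (j : ℝ) + 1) else 0 := by
  rcases lt_trichotomy j l with h | rfl | h
  · rw [if_neg h.ne]
    simp_rw [mul_comm (eval _ (legendre j))]
    exact integral_legendre_mul_legendre_of_lt h
  · simpa using integral_legendre_sq j
  · rw [if_neg h.ne']
    exact integral_legendre_mul_legendre_of_lt h

end Legendre

/-! ### Algebra of the matrices `A`, `Γ`, `T` and of the residual. -/

/-- The vector `(x^k / k!)_k`. -/
noncomputable def taylorVec (n : ℕ) (x : ℝ) : State n := fun k => x ^ (k : ℕ) / ((k : ℕ)! : ℝ)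

/-- The rows of `A` are signed Legendre coefficients; the factor `k!` cancels the denominators of
`taylorVec`. -/
lemma A_apply (n : ℕ) (j k : Fin (n + 1)) :
    A n j k = (-1) ^ (j : ℕ) * ((k : ℕ)! : ℝ) * (legendre j).coeff k := by
  rw [coeff_legendre]
  by_cases h : k ≤ j
  · have h' : (k : ℕ) ≤ j := h
    simp only [A, Matrix.of_apply, h, if_true]
    rw [Nat.cast_choose ℝ h', Nat.cast_add_choose ℝ, pow_add]
    have := Nat.factorial_pos (j - k : ℕ)
    field_simp
  · have h' : (j : ℕ) < k := not_le.mp h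
    simp [A, h, Nat.choose_eq_zero_of_lt h']

lemma A_mulVec_taylorVec (n : ℕ) (x : ℝ) (j : Fin (n + 1)) :
    (A n *ᵥ taylorVec n x) j = (-1) ^ (j : ℕ) * (legendre j).eval x := by
  rw [Polynomial.eval_eq_sum_range' ((natDegree_legendre_le j).trans_lt j.2), Finset.mul_sum,
    Finset.sum_range, Matrix.mulVec, dotProduct]
  refine Finset.sum_congr rfl fun k _ => ?_
  rw [A_apply, taylorVec]
  field_simp

lemma Γ_mulVec_taylorVec (n : ℕ) (x : ℝ) : Γ n *ᵥ taylorVec n x = taylorVec n (x + 1) := by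
  ext j
  simp only [taylorVec, Matrix.mulVec, dotProduct, Γ, Matrix.of_apply, Fin.le_def]
  rw [add_pow, Finset.sum_div]
  rw [Fin.sum_univ_eq_sum_range (fun k => (if k ≤ (j : ℕ) then 1 / (((j : ℕ) - k)! : ℝ) else 0) *
    (x ^ k / (k ! : ℝ))) (n + 1)]
  rw [← Finset.sum_subset (Finset.range_subset_range.2 (Nat.succ_le_succ (Fin.is_le j)))]
  · refine Finset.sum_congr rfl fun k hk => ?_
    have hk' : k ≤ (j : ℕ) := Nat.lt_succ_iff.1 (Finset.mem_range.1 hk)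
    rw [if_pos hk', Nat.cast_choose ℝ hk']
    simp
    field_simp
  · intro k _ hk
    have : ¬ k ≤ (j : ℕ) := fun h => hk (Finset.mem_range.2 (Nat.lt_succ_of_le h))
    simp [this]

/-- The polynomials `x^k / k!` are linearly independent, so identities between matrices can be
tested on the curve `taylorVec`. -/
lemma eq_of_forall_dotProduct_taylorVec {n : ℕ} {u v : State n}
    (h : ∀ x, u ⬝ᵥ taylorVec n x = v ⬝ᵥ taylorVec n x) : u = v := by
  have key : (∑ k : Fin (n + 1), Polynomial.C (u k / ((k : ℕ)! : ℝ)) * Polynomial.X ^ (k : ℕ)) =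
      ∑ k : Fin (n + 1), Polynomial.C (v k / ((k : ℕ)! : ℝ)) * Polynomial.X ^ (k : ℕ) := by
    refine Polynomial.funext fun x => ?_
    have := h x
    simp only [dotProduct, taylorVec] at this
    simp only [Polynomial.eval_finsetSum, Polynomial.eval_mul, Polynomial.eval_C,
      Polynomial.eval_pow, Polynomial.eval_X]
    convert this using 2 <;> ring
  ext k
  have := congrArg (fun p => Polynomial.coeff p k) key
  simp only [Polynomial.finsetSum_coeff, Polynomial.coeff_C_mul, Polynomial.coeff_X_pow,
    Fin.val_inj, mul_ite, mul_one, mul_zero, Finset.sum_ite_eq, Finset.mem_univ, if_true] at this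
  have hk : ((k : ℕ)! : ℝ) ≠ 0 := by positivity
  field_simp at this
  exact this

/-- On `taylorVec`, `Γ` acts by `x ↦ x + 1`, while the star operation amounts to `x ↦ -x` with a
sign `(-1)^j`. The two sides agree by the reflection symmetry of the Legendre polynomials about
`1/2`. -/
lemma A_mul_Γ (n : ℕ) : A n * Γ n = starMat (A n) := by
  refine funext fun j => eq_of_forall_dotProduct_taylorVec fun x => ?_
  have h1 : (A n * Γ n) j ⬝ᵥ taylorVec n x = (A n *ᵥ taylorVec n (x + 1)) j := by
    rw [← Γ_mulVec_taylorVec, Matrix.mulVec_mulVec]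
    rfl
  have h2 : starMat (A n) j ⬝ᵥ taylorVec n x = (-1) ^ (j : ℕ) * (A n *ᵥ taylorVec n (-x)) j := by
    simp only [Matrix.mulVec, dotProduct, starMat, Matrix.of_apply, taylorVec, Finset.mul_sum]
    refine Finset.sum_congr rfl fun k _ => ?_
    rw [neg_pow x, pow_add]
    ring
  have h3 : ((-1 : ℝ) ^ (j : ℕ)) * (-1) ^ (j : ℕ) = 1 := by rw [← mul_pow]; simp
  rw [h1, h2, A_mulVec_taylorVec, A_mulVec_taylorVec, legendre_eval_symm j (-x)]
  rw [show 1 - -x = x + 1 by ring]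
  linear_combination -(-1) ^ (j : ℕ) * (legendre j).eval (x + 1) * h3

lemma det_A (n : ℕ) : (A n).det = ∏ m ∈ Finset.range (n + 1), (((2 * m)! : ℝ) / (m ! : ℝ)) := by
  rw [Matrix.det_of_isLowerTriangular, Finset.prod_range]
  · refine Finset.prod_congr rfl fun m _ => ?_
    simp [A, ← two_mul]
  · intro i j hij
    have : ¬ (j ≤ i) := not_le.2 hij
    simp [A, this]

lemma prod_odd (n : ℕ) :
    ∏ k : Fin (n + 1), (2 * (k : ℝ) + 1) = ((2 * n + 1)! : ℝ) / ((2 : ℝ) ^ n * (n ! : ℝ)) := by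
  rw [Fin.prod_univ_eq_prod_range (fun k => 2 * (k : ℝ) + 1) (n + 1)]
  induction n with
  | zero => simp
  | succ n ih =>
    rw [Finset.prod_range_succ, ih, show 2 * (n + 1) + 1 = 2 * n + 1 + 1 + 1 by ring,
      Nat.factorial_succ (2 * n + 1 + 1), Nat.factorial_succ (2 * n + 1), Nat.factorial_succ n]
    push_cast
    field_simp
    ring

lemma det_T (n : ℕ) {t : ℝ} (ht : 0 < t) :
    (T n t).det = t ^ (-(((n : ℝ) + 1) ^ 2 / 2)) := by
  rw [T, Matrix.det_diagonal, ← Real.rpow_sum_of_pos ht]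
  congr 1
  rw [Fin.sum_univ_eq_sum_range (fun k => -((k : ℝ) + 1 / 2)) (n + 1)]
  induction n with
  | zero => norm_num
  | succ n ih =>
    rw [Finset.sum_range_succ, ih]
    push_cast
    ring

lemma det_T_pos (n : ℕ) {t : ℝ} (ht : 0 < t) : 0 < (T n t).det := by
  rw [det_T n ht]
  positivity

lemma T_mul_drift (n : ℕ) {t : ℝ} (ht : 0 < t) : T n t * drift n t = Γ n * T n t := by
  rw [drift, ← mul_assoc, ← mul_assoc, Matrix.mul_nonsing_inv _ (det_T_pos n ht).ne'.isUnit,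
    one_mul]

lemma drift_apply (n : ℕ) {t : ℝ} (ht : 0 < t) (j k : Fin (n + 1)) :
    drift n t j k = if k ≤ j then t ^ ((j : ℕ) - (k : ℕ)) / (((j : ℕ) - (k : ℕ))! : ℝ) else 0 := by
  have h := congrFun (congrFun (T_mul_drift n ht) j) k
  rw [T, Matrix.diagonal_mul, Matrix.mul_diagonal] at h
  have hpos := Real.rpow_pos_of_pos ht (-((j : ℝ) + 1 / 2))
  apply mul_left_cancel₀ hpos.ne'
  rw [h]
  simp only [Γ, Matrix.of_apply]
  split_ifs with hkj
  · have : t ^ (-((k : ℝ) + 1 / 2)) = t ^ (-((j : ℝ) + 1 / 2)) * t ^ ((j : ℕ) - (k : ℕ)) := by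
      rw [← Real.rpow_natCast t ((j : ℕ) - (k : ℕ)), ← Real.rpow_add ht, Nat.cast_sub hkj]
      congr 1
      ring
    rw [this]
    ring
  · simp

lemma residual_eq (n : ℕ) (t : ℝ) (a w : State n) :
    residual n t a w = A n *ᵥ (T n t *ᵥ w - (Γ n * T n t) *ᵥ a) := by
  rw [residual, ← A_mul_Γ, Matrix.mulVec_sub, Matrix.mulVec_mulVec, Matrix.mulVec_mulVec,
    mul_assoc]

/-- Starring moves the signs from the vectors to the matrix, so the terms in `A` and `A*` exchange
roles; the remaining sign disappears in a diagonal quadratic form. -/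
lemma residual_star (n : ℕ) (t : ℝ) (a w : State n) (j : Fin (n + 1)) :
    residual n t (starVec w) (starVec a) j = -(-1) ^ (j : ℕ) * residual n t a w j := by
  have h1 : ∀ i : ℕ, ((-1 : ℝ) ^ i) * (-1) ^ i = 1 := fun i => by rw [← mul_pow]; simp
  simp only [residual, Pi.sub_apply, Matrix.mulVec, dotProduct, T, Matrix.mul_diagonal, starVec,
    starMat, Matrix.of_apply]
  rw [neg_mul, ← mul_neg, neg_sub, mul_sub, Finset.mul_sum, Finset.mul_sum]
  congr 1 <;> refine Finset.sum_congr rfl fun k _ => ?_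
  · rw [pow_add]
    linear_combination (-(-1 : ℝ) ^ (k : ℕ) * A n j k * t ^ (-((k : ℝ) + 1 / 2)) * a k) *
      (h1 (j : ℕ))
  · rw [pow_add]
    linear_combination ((-1 : ℝ) ^ (j : ℕ) * A n j k * t ^ (-((k : ℝ) + 1 / 2)) * w k) *
      (h1 (k : ℕ))

lemma dotProduct_Λ_mulVec (n : ℕ) (r : State n) :
    r ⬝ᵥ (Λ n *ᵥ r) = ∑ k : Fin (n + 1), (2 * (k : ℝ) + 1) * r k ^ 2 := by
  simp only [dotProduct, Λ, Matrix.mulVec_diagonal]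
  exact Finset.sum_congr rfl fun k _ => by ring

lemma residual_quadratic_star (n : ℕ) (t : ℝ) (a w : State n) :
    residual n t (starVec w) (starVec a) ⬝ᵥ (Λ n *ᵥ residual n t (starVec w) (starVec a)) =
      residual n t a w ⬝ᵥ (Λ n *ᵥ residual n t a w) := by
  simp_rw [dotProduct_Λ_mulVec, residual_star, mul_pow, neg_sq, ← pow_mul, mul_comm _ 2, pow_mul]
  simp

/-! ### Pathwise identities for iterated integrals. -/

section Pathwise

variable {Ω : Type*} {B : ℝ≥0 → Ω → ℝ} {ω : Ω}

lemma continuous_integrated (hc : Continuous fun t => B t ω) (k : ℕ) :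
    Continuous fun t => integrated B k t ω := by
  induction k with
  | zero => exact hc
  | succ k ih =>
    have h : Continuous fun s : ℝ => integrated B k s.toNNReal ω :=
      ih.comp continuous_real_toNNReal
    exact (intervalIntegral.continuous_primitive (fun a b => h.intervalIntegrable a b) 0).comp
      NNReal.continuous_coe

lemma continuous_integrated_toNNReal (hc : Continuous fun t => B t ω) (k : ℕ) :
    Continuous fun s : ℝ => integrated B k s.toNNReal ω :=
  (continuous_integrated hc k).comp continuous_real_toNNReal

lemma integrated_succ (k : ℕ) (t : ℝ≥0) :
    integrated B (k + 1) t ω = ∫ s in (0 : ℝ)..t, integrated B k s.toNNReal ω := rfl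

lemma integrated_integrated (k : ℕ) (t : ℝ≥0) :
    integrated (integrated B 1) k t ω = integrated B (k + 1) t ω := by
  induction k generalizing t with
  | zero => rfl
  | succ k ih => rw [integrated_succ, integrated_succ]; simp_rw [ih]

/-- Cauchy's formula for repeated integration. -/
lemma integrated_succ_eq_integral (hc : Continuous fun t => B t ω) (k : ℕ) (t : ℝ≥0) :
    integrated B (k + 1) t ω =
      ∫ s in (0 : ℝ)..t, (t - s) ^ k / (k ! : ℝ) * B s.toNNReal ω := by
  induction k generalizing B with
  | zero => simp [integrated]
  | succ k ih =>
    -- The induction hypothesis is applied to the process `integrated B 1`; integration by parts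
    -- then moves the one remaining integration onto the kernel.
    rw [← integrated_integrated, ih (continuous_integrated hc 1)]
    have hb : Continuous fun s : ℝ => B s.toNNReal ω := hc.comp continuous_real_toNNReal
    have key := intervalIntegral.integral_mul_deriv_eq_deriv_mul (a := 0) (b := t)
      (u := fun s : ℝ => (t - s) ^ (k + 1) / ((k + 1)! : ℝ))
      (v := fun s => ∫ r in (0 : ℝ)..s, B r.toNNReal ω)
      (u' := fun s => -((t - s) ^ k / (k ! : ℝ))) (v' := fun s => B s.toNNReal ω)
      (fun s _ => by
        have := (((hasDerivAt_id s).const_sub (t : ℝ)).pow (k + 1)).div_const ((k + 1)! : ℝ)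
        convert! this using 1
        rw [Nat.factorial_succ]
        push_cast
        field_simp
        simp)
      (fun s _ => intervalIntegral.integral_hasDerivAt_right (hb.intervalIntegrable _ _)
        (hb.stronglyMeasurableAtFilter _ _) hb.continuousAt)
      ((by fun_prop : Continuous _).intervalIntegrable _ _) (hb.intervalIntegrable _ _)
    rw [key]
    simp only [sub_self, ne_eq, Nat.add_eq_zero_iff, one_ne_zero, and_false, not_false_eq_true,
      zero_pow, zero_div, zero_mul, intervalIntegral.integral_same, mul_zero, neg_mul,
      intervalIntegral.integral_neg, sub_neg_eq_add, zero_add]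
    refine intervalIntegral.integral_congr fun s hs => ?_
    rw [Set.uIcc_of_le t.coe_nonneg] at hs
    simp [integrated, Real.coe_toNNReal s hs.1]

/-- Decomposition of the iterated integrals at time `s`. -/
lemma integrated_add (hc : Continuous fun t => B t ω) (k : ℕ) (s t : ℝ≥0) :
    integrated B k (s + t) ω =
      ∑ j ∈ Finset.range (k + 1), (t : ℝ) ^ (k - j) / ((k - j)! : ℝ) * integrated B j s ω +
        integrated (fun u ω => B (s + u) ω - B s ω) k t ω := by
  have hc' : Continuous fun u => B (s + u) ω - B s ω := by fun_prop
  induction k generalizing t with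
  | zero => simp [integrated]
  | succ k ih =>
    have h := continuous_integrated_toNNReal hc k
    have h' := continuous_integrated_toNNReal (B := fun u ω => B (s + u) ω - B s ω) hc' k
    -- The integral over `[0, s]` is the new term `j = k + 1`; over `[s, s + t]` the decomposition
    -- at level `k` is integrated term by term.
    rw [integrated_succ, NNReal.coe_add, ← intervalIntegral.integral_add_adjacent_intervals
      (h.intervalIntegrable 0 s) (h.intervalIntegrable s (s + t)), ← integrated_succ]
    have h2 : ∫ r in (s : ℝ)..(s + t), integrated B k r.toNNReal ω =
        ∫ u in (0 : ℝ)..t, (∑ j ∈ Finset.range (k + 1),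
          u ^ (k - j) / ((k - j)! : ℝ) * integrated B j s ω +
            integrated (fun u ω => B (s + u) ω - B s ω) k u.toNNReal ω) := by
      have := intervalIntegral.integral_comp_add_left (a := 0) (b := t)
        (fun r => integrated B k r.toNNReal ω) (s : ℝ)
      rw [add_zero] at this
      rw [← this]
      refine intervalIntegral.integral_congr fun u hu => ?_
      rw [Set.uIcc_of_le t.coe_nonneg] at hu
      rw [Real.toNNReal_add s.coe_nonneg hu.1, Real.toNNReal_coe, ih]
      simp [Real.coe_toNNReal u hu.1]
    rw [h2, intervalIntegral.integral_add ((by fun_prop : Continuous _).intervalIntegrable _ _)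
      (h'.intervalIntegrable _ _), ← integrated_succ,
      intervalIntegral.integral_finsetSum
        (fun j _ => (by fun_prop : Continuous _).intervalIntegrable _ _),
      Finset.sum_range_succ _ (k + 1)]
    simp only [intervalIntegral.integral_mul_const, intervalIntegral.integral_div, integral_pow]
    have h3 : ∀ j ∈ Finset.range (k + 1),
        ((t : ℝ) ^ (k - j + 1) - 0 ^ (k - j + 1)) / (((k - j : ℕ) : ℝ) + 1) / ((k - j)! : ℝ) *
          integrated B j s ω =
        (t : ℝ) ^ (k + 1 - j) / ((k + 1 - j)! : ℝ) * integrated B j s ω := by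
      intro j hj
      have hj' : j ≤ k := Nat.lt_succ_iff.1 (Finset.mem_range.1 hj)
      rw [Nat.succ_sub hj', Nat.factorial_succ]
      push_cast
      simp
      left
      field_simp
    rw [Finset.sum_congr rfl h3]
    simp
    ring

/-- The values at time `s` propagate as Taylor coefficients, whose matrix is `drift n t`; what is
left is driven by the restarted path. -/
lemma W_add (hc : Continuous fun t => B t ω) (n : ℕ) (s : ℝ≥0) {t : ℝ≥0} (ht : 0 < t) :
    W B n (s + t) ω = drift n t *ᵥ W B n s ω + W (fun u ω => B (s + u) ω - B s ω) n t ω := by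
  ext j
  rw [W, integrated_add hc, Pi.add_apply]
  congr 1
  simp only [Matrix.mulVec, dotProduct, drift_apply n (NNReal.coe_pos.2 ht), W, Fin.le_def]
  rw [Fin.sum_univ_eq_sum_range (fun k => (if k ≤ (j : ℕ) then
    (t : ℝ) ^ ((j : ℕ) - k) / (((j : ℕ) - k)! : ℝ) else 0) * integrated B k s ω) (n + 1)]
  rw [← Finset.sum_subset (Finset.range_subset_range.2 (Nat.succ_le_succ (Fin.is_le j)))]
  · refine Finset.sum_congr rfl fun k hk => ?_
    rw [if_pos (Nat.lt_succ_iff.1 (Finset.mem_range.1 hk))]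
  · intro k _ hk
    have : ¬ k ≤ (j : ℕ) := fun h => hk (Finset.mem_range.2 (Nat.lt_succ_of_le h))
    simp [this]

lemma dotProduct_W (hc : Continuous fun t => B t ω) (n : ℕ) (t : ℝ≥0) (c : State n) :
    c ⬝ᵥ W B n t ω = c 0 * B t ω +
      ∫ s in (0 : ℝ)..t, (∑ k : Fin n, c k.succ * ((t - s) ^ (k : ℕ) / ((k : ℕ)! : ℝ))) *
        B s.toNNReal ω := by
  have hb : Continuous fun s : ℝ => B s.toNNReal ω := hc.comp continuous_real_toNNReal
  simp_rw [Finset.sum_mul, dotProduct]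
  rw [Fin.sum_univ_succ, intervalIntegral.integral_finsetSum
    (fun j _ => (by fun_prop : Continuous _).intervalIntegrable _ _)]
  congr 1
  refine Finset.sum_congr rfl fun k _ => ?_
  simp_rw [mul_assoc]
  rw [intervalIntegral.integral_const_mul, ← integrated_succ_eq_integral hc]
  rfl

end Pathwise

/-! ### Wiener integrals of smooth functions and their characteristic functions. -/

/-- With `g(s) = c ⬝ᵥ v(t - s)`, the kernel in `dotProduct_W` is `-g'`, so `c ⬝ᵥ W(t) = g(t) B_t - ∫
B g'`, the integrated-by-parts form of `∫ g dB`. -/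
lemma hasDerivAt_dotProduct_taylorVec (n : ℕ) (c : State n) (t s : ℝ) :
    HasDerivAt (fun s => c ⬝ᵥ taylorVec n (t - s))
      (-∑ k : Fin n, c k.succ * ((t - s) ^ (k : ℕ) / ((k : ℕ)! : ℝ))) s := by
  simp only [dotProduct, Fin.sum_univ_succ, taylorVec, ← Finset.sum_neg_distrib]
  rw [← zero_add (∑ k : Fin n, _)]
  refine HasDerivAt.add (by simpa using hasDerivAt_const s (c 0)) (HasDerivAt.fun_sum fun k _ => ?_)
  have := ((((hasDerivAt_id s).const_sub t).pow ((k : ℕ) + 1)).div_const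
    (((k : ℕ) + 1)! : ℝ)).const_mul (c k.succ)
  convert! this using 1
  rw [Nat.factorial_succ]
  push_cast
  field_simp
  simp

open Filter Topology in
/-- Riemann sums with weights `∫ h` over the pieces of the uniform partition. -/
lemma tendsto_riemann_sum {f h : ℝ → ℝ} (hf : Continuous f) (hh : Continuous h) {t : ℝ}
    (ht : 0 ≤ t) {e : ℝ} (he : e ∈ Set.Icc (0 : ℝ) 1) :
    Tendsto (fun N : ℕ => ∑ i ∈ Finset.range (N + 1), f ((i + e) * (t / (N + 1))) *
      ∫ s in (i * (t / (N + 1)))..((i + 1) * (t / (N + 1))), h s) atTop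
      (𝓝 (∫ s in (0 : ℝ)..t, f s * h s)) := by
  obtain ⟨M, hM⟩ := (isCompact_Icc (a := (0 : ℝ)) (b := t)).exists_bound_of_continuousOn
    hh.continuousOn
  have hM0 : 0 ≤ M := (norm_nonneg _).trans (hM 0 ⟨le_rfl, ht⟩)
  have huc := (isCompact_Icc (a := (0 : ℝ)) (b := t)).uniformContinuousOn_of_continuous
    hf.continuousOn
  rw [Metric.uniformContinuousOn_iff] at huc
  rw [Metric.tendsto_atTop]
  intro ε hε
  -- The total error is at most `ε M t / (M t + 1) < ε`; the `+ 1` covers the case `M t = 0`.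
  obtain ⟨δ, hδ, hδ'⟩ := huc (ε / (M * t + 1)) (by positivity)
  obtain ⟨N₀, hN₀⟩ := exists_nat_gt (t / δ)
  refine ⟨N₀, fun N hN => ?_⟩
  have hstep : t / (N + 1) < δ := by
    rw [div_lt_iff₀ (by positivity)]
    rw [div_lt_iff₀ hδ] at hN₀
    have : (N₀ : ℝ) ≤ N := by exact_mod_cast hN
    nlinarith
  have hstep0 : 0 ≤ t / (N + 1) := by positivity
  set d := t / ((N : ℝ) + 1) with hd
  have hNd : ((N : ℝ) + 1) * d = t := by rw [hd]; field_simp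
  have hsplit : ∫ s in (0 : ℝ)..t, f s * h s =
      ∑ i ∈ Finset.range (N + 1), ∫ s in (i * d)..((i + 1) * d), f s * h s := by
    have := intervalIntegral.sum_integral_adjacent_intervals (μ := volume)
      (f := fun s => f s * h s) (a := fun i : ℕ => i * d) (n := N + 1)
      (fun k _ => (hf.mul hh).intervalIntegrable _ _)
    push_cast at this
    rw [this, hNd, zero_mul]
  rw [hsplit, dist_eq_norm, ← Finset.sum_sub_distrib]
  have hpiece : ∀ i ∈ Finset.range (N + 1), ‖f ((i + e) * d) * (∫ s in (i * d)..((i + 1) * d), h s) -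
      ∫ s in (i * d)..((i + 1) * d), f s * h s‖ ≤ ε / (M * t + 1) * M * d := by
    intro i hi
    have hi' : (i : ℝ) + 1 ≤ N + 1 := by
      have := Finset.mem_range.1 hi
      exact_mod_cast this
    have hup : ((i : ℝ) + 1) * d ≤ t := hNd ▸ mul_le_mul_of_nonneg_right hi' hstep0
    have hlo : 0 ≤ (i : ℝ) * d := by positivity
    have h1 : (i : ℝ) * d ≤ (i + e) * d :=
      mul_le_mul_of_nonneg_right (by linarith [he.1]) hstep0
    have h2 : ((i : ℝ) + e) * d ≤ (i + 1) * d :=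
      mul_le_mul_of_nonneg_right (by linarith [he.2]) hstep0
    have h3 : ((i : ℝ) + 1) * d = i * d + d := by ring
    rw [← intervalIntegral.integral_const_mul, ← intervalIntegral.integral_sub
      ((by fun_prop : Continuous _).intervalIntegrable _ _)
      ((by fun_prop : Continuous _).intervalIntegrable _ _)]
    refine (intervalIntegral.norm_integral_le_of_norm_le_const
      (C := ε / (M * t + 1) * M) fun s hs => ?_).trans (le_of_eq ?_)
    · rw [Set.uIoc_of_le (by linarith)] at hs
      rw [← sub_mul, norm_mul]
      have hs' : s ∈ Set.Icc 0 t := ⟨by linarith [hs.1], by linarith [hs.2]⟩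
      refine mul_le_mul ?_ (hM s hs') (norm_nonneg _) (by positivity)
      rw [← dist_eq_norm]
      refine (hδ' _ ⟨by linarith, by linarith⟩ _ hs' ?_).le
      rw [Real.dist_eq, abs_lt]
      constructor <;> linarith [hs.1, hs.2]
    · rw [h3, add_sub_cancel_left, abs_of_nonneg hstep0]
  calc _ ≤ ∑ i ∈ Finset.range (N + 1), ε / (M * t + 1) * M * d := norm_sum_le_of_le _ hpiece
    _ = ε / (M * t + 1) * (M * t) := by
      rw [Finset.sum_const, Finset.card_range, nsmul_eq_mul]
      push_cast
      rw [← hNd]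
      ring
    _ < ε := by
      rw [div_mul_eq_mul_div, div_lt_iff₀ (by positivity)]
      nlinarith

/-- A Brownian motion all of whose paths are continuous and start at `0`. -/
structure IsRegularBrownian {Ω : Type*} [MeasurableSpace Ω] (B : ℝ≥0 → Ω → ℝ) (P : Measure Ω) :
    Prop extends IsPreBrownianReal B P where
  measurable : ∀ t, Measurable (B t)
  continuous : ∀ ω, Continuous fun t => B t ω
  zero : ∀ ω, B 0 ω = 0

/-- Abel summation, the discrete form of the integration by parts that defines the Wiener integral
pathwise. -/
lemma sum_range_mul_sub (g b : ℕ → ℝ) (m : ℕ) :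
    ∑ i ∈ Finset.range m, g i * (b (i + 1) - b i) =
      g m * b m - g 0 * b 0 - ∑ i ∈ Finset.range m, b (i + 1) * (g (i + 1) - g i) := by
  induction m with
  | zero => simp
  | succ m ih => rw [Finset.sum_range_succ, Finset.sum_range_succ, ih]; ring

section

variable {Ω : Type*} [MeasurableSpace Ω] {P : Measure Ω} {B : ℝ≥0 → Ω → ℝ}

/-- The increments are independent centred Gaussians, so the variances `g_i² (τ_{i+1} - τ_i)` add
up. -/
lemma charFun_sum_increments (hB : IsPreBrownianReal B P) (g : ℕ → ℝ) {τ : ℕ → ℝ≥0}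
    (hτ : Monotone τ) (m : ℕ) :
    ∫ ω, Complex.exp
        ((∑ i ∈ Finset.range m, g i * (B (τ (i + 1)) ω - B (τ i) ω) : ℝ) * Complex.I) ∂P =
      Complex.exp (-(1 / 2) *
        (∑ i ∈ Finset.range m, g i ^ 2 * ((τ (i + 1) : ℝ) - τ i) : ℝ)) := by
  have hmeas : ∀ i, AEMeasurable (fun ω => g i * (B (τ (i + 1)) ω - B (τ i) ω)) P := fun i =>
    ((hB.aemeasurable _).sub (hB.aemeasurable _)).const_mul _
  have hind : iIndepFun (fun (i : ℕ) ω => g i * (B (τ (i + 1)) ω - B (τ i) ω)) P :=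
    (hB.hasIndepIncrements.nat hτ).comp (fun i x => g i * x) (fun i => measurable_const_mul _)
  have key := congrFun (iIndepFun.charFun_map_fun_finsetSum_eq_prod (s := Finset.range m)
    (fun i _ => hmeas i) (hind.restrict _)) 1
  rw [charFun_apply_real, integral_map (Finset.aemeasurable_fun_sum _ fun i _ => hmeas i)
    (by fun_prop)] at key
  simp only [Complex.ofReal_one, one_mul] at key
  rw [key, Finset.prod_apply, Complex.ofReal_sum, Finset.mul_sum, Complex.exp_sum]
  refine Finset.prod_congr rfl fun i _ => ?_
  have hlaw := hB.hasLaw_sub (τ (i + 1)) (τ i)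
  have h2 : P.map (fun ω => g i * (B (τ (i + 1)) ω - B (τ i) ω)) =
      (P.map (B (τ (i + 1)) - B (τ i))).map (g i * ·) := by
    rw [AEMeasurable.map_map_of_aemeasurable (by fun_prop) hlaw.aemeasurable]
    rfl
  rw [h2, hlaw.map_eq, charFun_map_mul, charFun_gaussianReal]
  have h3 : ((nndist (τ (i + 1)).1 (τ i).1 : ℝ≥0) : ℝ) = (τ (i + 1) : ℝ) - τ i := by
    rw [coe_nndist, Real.dist_eq, abs_of_nonneg]
    · rfl
    · exact sub_nonneg.2 (hτ (Nat.le_succ i))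
  have h4 : (((nndist (τ (i + 1)).1 (τ i).1 : ℝ≥0) : ℝ) : ℂ) = (τ (i + 1) : ℝ) - (τ i : ℝ) := by
    rw [h3]
    simp
  rw [h4]
  push_cast
  congr 1
  ring

open Filter Topology in
-- The sums `∑ g ΔB` converge pathwise after Abel summation, because `g` is `C¹`; their
-- characteristic functions converge both by dominated convergence and by the explicit Gaussian
-- formula, and the two limits coincide.
lemma integral_exp_wiener (hB : IsRegularBrownian B P) {g g' : ℝ → ℝ}
    (hg : ∀ s, HasDerivAt g (g' s) s) (hg' : Continuous g') (t : ℝ≥0) :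
    ∫ ω, Complex.exp ((g t * B t ω - ∫ s in (0 : ℝ)..t, B s.toNNReal ω * g' s : ℝ) *
        Complex.I) ∂P =
      Complex.exp (-(1 / 2) * (∫ s in (0 : ℝ)..t, g s ^ 2 : ℝ)) := by
  have : IsProbabilityMeasure P := hB.isGaussianProcess.isProbabilityMeasure
  have hgc : Continuous g := continuous_iff_continuousAt.2 fun s => (hg s).continuousAt
  let τ : ℕ → ℕ → ℝ≥0 := fun N i => i * (t / (N + 1))
  have hτ : ∀ N, Monotone (τ N) := fun N i j hij => by
    have : (i : ℝ≥0) ≤ j := by exact_mod_cast hij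
    exact mul_le_mul_left this _
  have hτc : ∀ N i, (τ N i : ℝ) = i * ((t : ℝ) / (N + 1)) := fun N i => by simp [τ]
  let S : ℕ → Ω → ℝ := fun N ω =>
    ∑ i ∈ Finset.range (N + 1), g (τ N i) * (B (τ N (i + 1)) ω - B (τ N i) ω)
  have hSlim : ∀ ω, Tendsto (fun N => S N ω) atTop
      (𝓝 (g t * B t ω - ∫ s in (0 : ℝ)..t, B s.toNNReal ω * g' s)) := by
    intro ω
    have hS : ∀ N, S N ω = g t * B t ω - ∑ i ∈ Finset.range (N + 1),
        B (((i : ℝ) + 1) * (t / (N + 1))).toNNReal ω *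
          ∫ s in (i * ((t : ℝ) / (N + 1)))..((i + 1) * ((t : ℝ) / (N + 1))), g' s := by
      intro N
      have h1 := sum_range_mul_sub (fun i => g (τ N i)) (fun i => B (τ N i) ω) (N + 1)
      have h2 : τ N (N + 1) = t := by
        rw [← NNReal.coe_inj, hτc]
        push_cast
        field_simp
      have h3 : τ N 0 = 0 := by simp [τ]
      simp only [h2, h3, hB.zero ω, mul_zero, sub_zero] at h1
      simp only [S]
      rw [h1]
      congr 1
      refine Finset.sum_congr rfl fun i _ => ?_
      rw [intervalIntegral.integral_eq_sub_of_hasDerivAt (fun s _ => hg s)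
        (hg'.intervalIntegrable _ _)]
      have h4 : (((i : ℝ) + 1) * (t / (N + 1))).toNNReal = τ N (i + 1) := by
        rw [← Real.toNNReal_coe (r := τ N (i + 1)), hτc]
        push_cast
        rfl
      rw [h4, hτc, hτc]
      push_cast
      rfl
    simp_rw [hS]
    -- Abel summation evaluates `B` at right endpoints, hence `e = 1`; the variance sum below
    -- evaluates `g` at left endpoints, hence `e = 0`.
    exact (tendsto_riemann_sum ((hB.continuous ω).comp continuous_real_toNNReal) hg' t.coe_nonneg
      (e := 1) ⟨zero_le_one, le_rfl⟩).const_sub _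
  have hSmeas : ∀ N, Measurable (S N) := fun N => by
    have := hB.measurable
    fun_prop
  have hlim1 : Tendsto (fun N => ∫ ω, Complex.exp ((S N ω : ℝ) * Complex.I) ∂P) atTop
      (𝓝 (∫ ω, Complex.exp ((g t * B t ω - ∫ s in (0 : ℝ)..t, B s.toNNReal ω * g' s : ℝ) *
        Complex.I) ∂P)) := by
    refine tendsto_integral_of_dominated_convergence (fun _ => 1) (fun N => ?_)
      (integrable_const _) (fun N => ?_) ?_
    · have := hSmeas N
      fun_prop
    · exact ae_of_all _ fun ω => (Complex.norm_exp_ofReal_mul_I _).le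
    · refine ae_of_all _ fun ω => ?_
      have hcont : Continuous fun x : ℝ => Complex.exp ((x : ℂ) * Complex.I) := by fun_prop
      exact (hcont.tendsto _).comp (hSlim ω)
  have hlim2 : Tendsto (fun N => ∫ ω, Complex.exp ((S N ω : ℝ) * Complex.I) ∂P) atTop
      (𝓝 (Complex.exp (-(1 / 2) * (∫ s in (0 : ℝ)..t, g s ^ 2 : ℝ)))) := by
    have h1 := fun N => charFun_sum_increments hB.toIsPreBrownianReal (fun i => g (τ N i)) (hτ N)
      (N + 1)
    simp only [S, h1]
    have hcont : Continuous fun x : ℝ => Complex.exp (-(1 / 2) * (x : ℂ)) := by fun_prop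
    refine (hcont.tendsto _).comp ?_
    have h2 := tendsto_riemann_sum (f := fun s => g s ^ 2) (h := fun _ => 1) (by fun_prop)
      continuous_const t.coe_nonneg (e := 0) ⟨le_rfl, zero_le_one⟩
    simp only [mul_one] at h2
    refine h2.congr fun N => Finset.sum_congr rfl fun i _ => ?_
    rw [intervalIntegral.integral_const, hτc, hτc]
    push_cast
    simp
  exact tendsto_nhds_unique hlim1 hlim2

end

/-! ### Adaptedness of the iterated integrals. -/

section Measurability

variable {Ω : Type*} {m : MeasurableSpace Ω} {B : ℝ≥0 → Ω → ℝ}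

/-- Iterated integrals up to time `s` are measurable with respect to any `σ`-algebra for which the
values of the process up to time `s` are. -/
lemma measurable_integrated (hc : ∀ ω, Continuous fun t => B t ω) {s : ℝ≥0}
    (hm : ∀ r ≤ s, Measurable (B r)) (k : ℕ) :
    ∀ r ≤ s, Measurable (integrated B k r) := by
  induction k with
  | zero => exact hm
  | succ k ih =>
    intro r hr
    -- The cut-off at `s` makes the integrand measurable for every `u`, although only times up to
    -- `s` are controlled; it changes nothing on `(0, r]`.
    have hjoint : Measurable (Function.uncurry fun (u : ℝ) ω =>
        integrated B k (min u.toNNReal s) ω) :=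
      measurable_uncurry_of_continuous_of_measurable
        (fun ω => (continuous_integrated (hc ω) k).comp
          (continuous_real_toNNReal.min continuous_const))
        (fun u => ih _ (min_le_right _ _))
    have h1 : StronglyMeasurable fun ω => ∫ u in Set.Ioc (0 : ℝ) r,
        integrated B k (min u.toNNReal s) ω :=
      StronglyMeasurable.integral_prod_right (f := fun ω (u : ℝ) => integrated B k (min u.toNNReal s) ω)
        (hjoint.comp measurable_swap).stronglyMeasurable
    convert h1.measurable using 1
    ext ω
    rw [integrated_succ, intervalIntegral.integral_of_le r.coe_nonneg]
    refine setIntegral_congr_fun measurableSet_Ioc fun u hu => ?_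
    have : u.toNNReal ≤ s := (Real.toNNReal_le_iff_le_coe.2 hu.2).trans hr
    simp [this]

lemma measurable_W (hc : ∀ ω, Continuous fun t => B t ω) {s : ℝ≥0}
    (hm : ∀ r ≤ s, Measurable (B r)) (n : ℕ) {r : ℝ≥0} (hr : r ≤ s) : Measurable (W B n r) :=
  measurable_pi_lambda _ fun k => measurable_integrated hc hm k r hr

end Measurability

/-! ### Orthonormalisation by normalised Legendre polynomials. -/

/-- The matrix turning `W(t)` into a standard Gaussian vector. -/
noncomputable def whitening (n : ℕ) : Matrix (Fin (n + 1)) (Fin (n + 1)) ℝ :=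
  Matrix.diagonal (fun k : Fin (n + 1) => Real.sqrt (2 * (k : ℝ) + 1)) * A n

lemma T_mulVec_taylorVec (n : ℕ) {t : ℝ} (ht : 0 < t) (x : ℝ) :
    T n t *ᵥ taylorVec n x = t ^ (-(1 / 2) : ℝ) • taylorVec n (x / t) := by
  ext k
  rw [T, Matrix.mulVec_diagonal, Pi.smul_apply, smul_eq_mul, taylorVec, taylorVec, div_pow,
    neg_add, Real.rpow_add ht, Real.rpow_neg ht.le, Real.rpow_natCast]
  field_simp

lemma whitening_mulVec_taylorVec (n : ℕ) (x : ℝ) (j : Fin (n + 1)) :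
    (whitening n *ᵥ taylorVec n x) j =
      Real.sqrt (2 * (j : ℝ) + 1) * ((-1) ^ (j : ℕ) * (legendre j).eval x) := by
  rw [whitening, ← Matrix.mulVec_mulVec, Matrix.mulVec_diagonal, A_mulVec_taylorVec]

/-- Parseval's identity: the components of `whitening n *ᵥ taylorVec n x` are orthonormal in `L²(0,
1)`. -/
lemma integral_whitening_taylorVec_sq (n : ℕ) (θ : State n) :
    ∫ x in (0 : ℝ)..1, (θ ⬝ᵥ (whitening n *ᵥ taylorVec n x)) ^ 2 = ∑ j, θ j ^ 2 := by
  simp_rw [sq, dotProduct, whitening_mulVec_taylorVec, Finset.sum_mul_sum]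
  have hc : ∀ j l : Fin (n + 1), Continuous fun x =>
      θ j * (Real.sqrt (2 * (j : ℝ) + 1) * ((-1) ^ (j : ℕ) * (legendre j).eval x)) *
        (θ l * (Real.sqrt (2 * (l : ℝ) + 1) * ((-1) ^ (l : ℕ) * (legendre l).eval x))) :=
    fun j l => by fun_prop
  rw [intervalIntegral.integral_finsetSum fun j _ =>
    (continuous_finsetSum _ fun l _ => hc j l).intervalIntegrable _ _]
  refine Finset.sum_congr rfl fun j _ => ?_
  rw [intervalIntegral.integral_finsetSum fun l _ => (hc j l).intervalIntegrable _ _]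
  have h : ∀ l : Fin (n + 1), ∫ x in (0 : ℝ)..1,
      θ j * (Real.sqrt (2 * (j : ℝ) + 1) * ((-1) ^ (j : ℕ) * (legendre j).eval x)) *
        (θ l * (Real.sqrt (2 * (l : ℝ) + 1) * ((-1) ^ (l : ℕ) * (legendre l).eval x))) =
      if j = l then θ j * θ j else 0 := by
    intro l
    have h1 : ∀ x, θ j * (Real.sqrt (2 * (j : ℝ) + 1) * ((-1) ^ (j : ℕ) * (legendre j).eval x)) *
        (θ l * (Real.sqrt (2 * (l : ℝ) + 1) * ((-1) ^ (l : ℕ) * (legendre l).eval x))) =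
        (θ j * Real.sqrt (2 * (j : ℝ) + 1) * (-1) ^ (j : ℕ) *
          (θ l * Real.sqrt (2 * (l : ℝ) + 1) * (-1) ^ (l : ℕ))) *
          ((legendre j).eval x * (legendre l).eval x) := fun x => by ring
    simp_rw [h1]
    rw [intervalIntegral.integral_const_mul, integral_legendre_mul_legendre]
    by_cases hjl : j = l
    · subst hjl
      have h2 : Real.sqrt (2 * (j : ℝ) + 1) * Real.sqrt (2 * (j : ℝ) + 1) = 2 * (j : ℝ) + 1 :=
        Real.mul_self_sqrt (by positivity)
      have h3 : ((-1 : ℝ) ^ (j : ℕ)) * (-1) ^ (j : ℕ) = 1 := by rw [← mul_pow]; simp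
      have h4 : (2 * (j : ℝ) + 1) ≠ 0 := by positivity
      simp only [if_true]
      calc _ = θ j * θ j * (Real.sqrt (2 * (j : ℝ) + 1) * Real.sqrt (2 * (j : ℝ) + 1)) *
            ((-1) ^ (j : ℕ) * (-1) ^ (j : ℕ)) * (1 / (2 * (j : ℝ) + 1)) := by ring
        _ = θ j * θ j := by rw [h2, h3]; field_simp
    · have hjl' : (j : ℕ) ≠ l := fun h => hjl (Fin.ext h)
      simp [hjl, hjl']
  simp [h]

lemma det_whitening (n : ℕ) : (whitening n).det =
    Real.sqrt (((2 * n + 1)! : ℝ) / ((2 : ℝ) ^ n * (n ! : ℝ))) *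
      ∏ m ∈ Finset.range (n + 1), (((2 * m)! : ℝ) / (m ! : ℝ)) := by
  rw [whitening, Matrix.det_mul, Matrix.det_diagonal, det_A, ← prod_odd,
    Real.sqrt_prod _ fun k _ => by positivity]

lemma det_whitening_pos (n : ℕ) : 0 < (whitening n).det := by
  rw [det_whitening]
  positivity

/-! ### Gaussian densities under affine maps. -/

section Density

/-- The standard Gaussian measure has the product density. -/
lemma pi_gaussianReal (n : ℕ) : Measure.pi (fun _ : Fin (n + 1) => gaussianReal 0 1) =
    withLebesgueDensity fun x : State n => ∏ k, gaussianPDFReal 0 1 (x k) := by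
  refine Measure.pi_eq fun s hs => ?_
  rw [withLebesgueDensity, withDensity_apply _ (MeasurableSet.univ_pi hs), volume_pi,
    Measure.restrict_pi_pi, ← ofReal_integral_eq_lintegral_ofReal, integral_fintype_prod_eq_prod,
    ENNReal.ofReal_prod_of_nonneg fun k _ => integral_nonneg (gaussianPDFReal_nonneg 0 1)]
  · simp_rw [gaussianReal_apply_eq_integral 0 one_ne_zero]
  · exact Integrable.fintype_prod fun k => (integrable_gaussianPDFReal 0 1).restrict
  · exact ae_of_all _ fun x => Finset.prod_nonneg fun k _ => gaussianPDFReal_nonneg 0 1 _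

lemma lintegral_affine {n : ℕ} {M : Matrix (Fin (n + 1)) (Fin (n + 1)) ℝ} (hM : 0 < M.det)
    (b : State n) {F : State n → ENNReal} (hF : Measurable F) :
    ENNReal.ofReal M.det * ∫⁻ y, F (M *ᵥ y - b) = ∫⁻ z, F z := by
  have h1 : ∫⁻ y, F (M *ᵥ y - b) = ∫⁻ z, F (z - b) ∂(volume.map (Matrix.toLin' M)) := by
    rw [lintegral_map (f := fun z => F (z - b)) (hF.comp (measurable_sub_const b))
      (LinearMap.continuous_of_finiteDimensional _).measurable]
    rfl
  rw [h1, Real.map_matrix_volume_pi_eq_smul_volume_pi hM.ne', lintegral_smul_measure,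
    lintegral_sub_right_eq_self, smul_eq_mul, ← mul_assoc, ← ENNReal.ofReal_mul hM.le,
    abs_of_pos (inv_pos.2 hM), mul_inv_cancel₀ hM.ne', ENNReal.ofReal_one, one_mul]

/-- Affine change of variables for a density. -/
lemma map_withLebesgueDensity {n : ℕ} {M : Matrix (Fin (n + 1)) (Fin (n + 1)) ℝ} (hM : 0 < M.det)
    (b : State n) {q : State n → ℝ} (hq : Measurable q) :
    (withLebesgueDensity q).map (fun z => M⁻¹ *ᵥ (z + b)) =
      withLebesgueDensity fun y => M.det * q (M *ᵥ y - b) := by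
  have hmeas : Measurable fun z : State n => M⁻¹ *ᵥ (z + b) := by fun_prop
  ext s hs
  rw [Measure.map_apply hmeas hs, withLebesgueDensity, withLebesgueDensity,
    withDensity_apply _ (hmeas hs), withDensity_apply _ hs, ← lintegral_indicator (hmeas hs),
    ← lintegral_indicator hs, ← lintegral_affine hM b
      (F := ((fun z => M⁻¹ *ᵥ (z + b)) ⁻¹' s).indicator fun z => ENNReal.ofReal (q z))
      ((ENNReal.measurable_ofReal.comp hq).indicator (hmeas hs)),
    ← lintegral_const_mul' _ _ ENNReal.ofReal_ne_top]
  congr 1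
  ext y
  have h1 : M⁻¹ *ᵥ (M *ᵥ y - b + b) = y := by
    rw [sub_add_cancel, Matrix.mulVec_mulVec, Matrix.nonsing_inv_mul _ hM.ne'.isUnit,
      Matrix.one_mulVec]
  have h2 : M *ᵥ y - b ∈ (fun z => M⁻¹ *ᵥ (z + b)) ⁻¹' s ↔ y ∈ s := by
    rw [Set.mem_preimage, h1]
  by_cases hy : y ∈ s
  · rw [Set.indicator_of_mem (h2.2 hy), Set.indicator_of_mem hy, ENNReal.ofReal_mul hM.le]
  · rw [Set.indicator_of_notMem (mt h2.1 hy), Set.indicator_of_notMem hy, mul_zero]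

/-- The density of `X(s)`. -/
noncomputable def stationaryDensity (n : ℕ) (x : State n) : ℝ :=
  K n * Real.exp (-(1 / 2) * ((A n *ᵥ x) ⬝ᵥ (Λ n *ᵥ (A n *ᵥ x))))

lemma K_pos (n : ℕ) : 0 < K n := by
  unfold K
  have := Real.pi_pos
  positivity

lemma stationaryDensity_pos (n : ℕ) (x : State n) : 0 < stationaryDensity n x :=
  mul_pos (K_pos n) (Real.exp_pos _)

lemma continuous_stationaryDensity (n : ℕ) : Continuous (stationaryDensity n) := by
  unfold stationaryDensity
  fun_prop

/-- The squared Euclidean norm of `Λ^{1/2} A x` is the quadratic form in the exponent, and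
`det_whitening` supplies the rest of `K_n`. -/
lemma stationaryDensity_eq (n : ℕ) (x : State n) : stationaryDensity n x =
    (whitening n).det * ∏ k, gaussianPDFReal 0 1 ((whitening n *ᵥ x) k) := by
  simp only [gaussianPDFReal, Finset.prod_mul_distrib, ← Real.exp_sum, Finset.prod_const,
    Finset.card_univ, Fintype.card_fin, NNReal.coe_one, mul_one, sub_zero]
  rw [stationaryDensity, dotProduct_Λ_mulVec, K, det_whitening]
  have h1 : (Real.sqrt (2 * Real.pi))⁻¹ ^ (n + 1) = 1 / (2 * Real.pi) ^ (((n : ℝ) + 1) / 2) := by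
    have h : (2 * Real.pi) ^ (((n : ℝ) + 1) / 2) = Real.sqrt (2 * Real.pi) ^ (n + 1) := by
      rw [Real.sqrt_eq_rpow, ← Real.rpow_natCast (_ ^ _), ← Real.rpow_mul (by positivity)]
      push_cast
      ring_nf
    rw [h, inv_pow, one_div]
  have h2 : ∀ k : Fin (n + 1), (whitening n *ᵥ x) k ^ 2 = (2 * (k : ℝ) + 1) * (A n *ᵥ x) k ^ 2 := by
    intro k
    rw [whitening, ← Matrix.mulVec_mulVec, Matrix.mulVec_diagonal, mul_pow,
      Real.sq_sqrt (by positivity)]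
  rw [h1]
  simp_rw [h2]
  rw [Finset.mul_sum]
  have h3 : ∀ k : Fin (n + 1), -(1 / 2) * ((2 * (k : ℝ) + 1) * (A n *ᵥ x) k ^ 2) =
    -((2 * (k : ℝ) + 1) * (A n *ᵥ x) k ^ 2) / 2 := fun k => by ring
  simp_rw [h3]
  ring

lemma map_pi_gaussianReal_whitening (n : ℕ) :
    (Measure.pi (fun _ : Fin (n + 1) => gaussianReal 0 1)).map (fun z => (whitening n)⁻¹ *ᵥ z) =
      withLebesgueDensity (stationaryDensity n) := by
  rw [pi_gaussianReal]
  have := map_withLebesgueDensity (det_whitening_pos n) 0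
    (q := fun x : State n => ∏ k, gaussianPDFReal 0 1 (x k))
    (Finset.measurable_fun_prod _ fun k _ =>
      (measurable_gaussianPDFReal 0 1).comp (measurable_pi_apply (X := fun _ => ℝ) k))
  simp only [add_zero, sub_zero] at this
  rw [this]
  congr 1
  ext x
  rw [stationaryDensity_eq]

/-- The transition density of `W`. -/
noncomputable def transitionDensity (n : ℕ) (t : ℝ≥0) (a w : State n) : ℝ :=
  (T n t).det * stationaryDensity n (T n t *ᵥ w - (Γ n * T n t) *ᵥ a)

end Density

/-! ### The law of `W(t)`. -/

section Law

variable {Ω : Type*} [MeasurableSpace Ω] {P : Measure Ω} {B : ℝ≥0 → Ω → ℝ}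

lemma IsRegularBrownian.measurable_W (hB : IsRegularBrownian B P) (n : ℕ) (t : ℝ≥0) :
    Measurable (W B n t) :=
  IntegratedBrownian.measurable_W hB.continuous (fun r _ => hB.measurable r) n le_rfl

lemma integral_exp_dotProduct_W (hB : IsRegularBrownian B P) (n : ℕ) (t : ℝ≥0) (c : State n) :
    ∫ ω, Complex.exp ((c ⬝ᵥ W B n t ω : ℝ) * Complex.I) ∂P =
      Complex.exp (-(1 / 2) * (∫ s in (0 : ℝ)..t, (c ⬝ᵥ taylorVec n (t - s)) ^ 2 : ℝ)) := by
  rw [← integral_exp_wiener hB (fun s => hasDerivAt_dotProduct_taylorVec n c t s) (by fun_prop) t]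
  congr 1
  ext ω
  rw [dotProduct_W (hB.continuous ω)]
  have h0 : c ⬝ᵥ taylorVec n ((t : ℝ) - t) = c 0 := by
    simp [dotProduct, taylorVec, Fin.sum_univ_succ]
  rw [h0]
  simp only [mul_neg, intervalIntegral.integral_neg, sub_neg_eq_add]
  simp_rw [mul_comm (B _ ω)]

/-- The characteristic function decides: substituting `x = 1 - s / t` turns the variance integral
into the one over `[0, 1]`, and orthonormality evaluates it to `∑ θ_j²`. -/
lemma hasLaw_whitening_W (hB : IsRegularBrownian B P) (n : ℕ) {t : ℝ≥0} (ht : 0 < t) :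
    HasLaw (fun ω => (whitening n * T n t) *ᵥ W B n t ω)
      (Measure.pi fun _ => gaussianReal 0 1) P := by
  have hP : IsProbabilityMeasure P := hB.isGaussianProcess.isProbabilityMeasure
  have hm : Measurable fun ω => (whitening n * T n t) *ᵥ W B n t ω := by
    have := hB.measurable_W n t
    fun_prop
  refine ⟨hm.aemeasurable, ?_⟩
  have := Measure.isProbabilityMeasure_map (μ := P) hm.aemeasurable
  rw [← charFun_eq_pi_iff]
  intro θ
  have ht' : (0 : ℝ) < t := ht
  rw [Measure.map_map (by fun_prop) hm, charFun_apply, integral_map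
    (by fun_prop : Measurable _).aemeasurable (by fun_prop)]
  have h1 : ∀ ω, inner ℝ ((WithLp.toLp 2 ∘ fun ω => (whitening n * T n t) *ᵥ W B n t ω) ω) θ =
      (WithLp.ofLp θ ᵥ* (whitening n * T n t)) ⬝ᵥ W B n t ω := by
    intro ω
    rw [← Matrix.dotProduct_mulVec]
    simp [PiLp.inner_apply, dotProduct, mul_comm]
  simp_rw [h1]
  rw [integral_exp_dotProduct_W hB]
  have h2 : ∫ s in (0 : ℝ)..t,
      ((WithLp.ofLp θ ᵥ* (whitening n * T n t)) ⬝ᵥ taylorVec n (t - s)) ^ 2 = ∑ j, θ j ^ 2 := by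
    have h3 : ∀ s : ℝ, ((WithLp.ofLp θ ᵥ* (whitening n * T n t)) ⬝ᵥ taylorVec n (t - s)) ^ 2 =
        (t : ℝ)⁻¹ * (WithLp.ofLp θ ⬝ᵥ (whitening n *ᵥ taylorVec n (1 - s / t))) ^ 2 := by
      intro s
      rw [← Matrix.dotProduct_mulVec, ← Matrix.mulVec_mulVec, T_mulVec_taylorVec n ht',
        Matrix.mulVec_smul, dotProduct_smul, smul_eq_mul, mul_pow, sub_div, div_self ht'.ne',
        ← Real.rpow_natCast (_ ^ _), ← Real.rpow_mul ht'.le]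
      norm_num
      rw [Real.rpow_neg_one]
      simp
    simp_rw [h3]
    rw [intervalIntegral.integral_const_mul,
      intervalIntegral.integral_comp_sub_div
        (fun x => (WithLp.ofLp θ ⬝ᵥ (whitening n *ᵥ taylorVec n x)) ^ 2) ht'.ne',
      div_self ht'.ne', sub_self, zero_div, sub_zero, integral_whitening_taylorVec_sq, smul_eq_mul,
      ← mul_assoc, inv_mul_cancel₀ ht'.ne', one_mul]
  rw [h2]
  simp_rw [charFun_gaussianReal]
  rw [← Complex.exp_sum]
  congr 1
  push_cast
  rw [Finset.mul_sum]
  exact Finset.sum_congr rfl fun j _ => by ring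

lemma hasLaw_T_mulVec_W (hB : IsRegularBrownian B P) (n : ℕ) {t : ℝ≥0} (ht : 0 < t) :
    HasLaw (fun ω => T n t *ᵥ W B n t ω) (withLebesgueDensity (stationaryDensity n)) P := by
  rw [← map_pi_gaussianReal_whitening]
  have h := (hasLaw_whitening_W hB n ht)
  refine ⟨by have := hB.measurable_W n t; fun_prop, ?_⟩
  rw [← h.map_eq, AEMeasurable.map_map_of_aemeasurable (by fun_prop) h.aemeasurable]
  congr 1
  ext1 ω
  simp only [Function.comp]
  rw [Matrix.mulVec_mulVec, ← mul_assoc, Matrix.nonsing_inv_mul _ (det_whitening_pos n).ne'.isUnit,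
    one_mul]

lemma map_drift_add_W (hB : IsRegularBrownian B P) (n : ℕ) {t : ℝ≥0} (ht : 0 < t) (a : State n) :
    P.map (fun ω => drift n t *ᵥ a + W B n t ω) =
      withLebesgueDensity (transitionDensity n t a) := by
  have h := hasLaw_T_mulVec_W hB n ht
  have hT := det_T_pos n (NNReal.coe_pos.2 ht)
  have := map_withLebesgueDensity hT ((Γ n * T n t) *ᵥ a)
    (continuous_stationaryDensity n).measurable
  unfold transitionDensity
  rw [← this, ← h.map_eq, AEMeasurable.map_map_of_aemeasurable (by fun_prop) h.aemeasurable]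
  congr 1
  ext1 ω
  simp only [Function.comp]
  rw [Matrix.mulVec_add, Matrix.mulVec_mulVec, Matrix.mulVec_mulVec,
    Matrix.nonsing_inv_mul _ hT.ne'.isUnit, Matrix.one_mulVec, drift, mul_assoc]
  exact add_comm _ _

end Law

/-! ### The past of the process, and pathwise congruences. -/

section Paths

variable {Ω : Type*}

/-- The `σ`-algebra generated by a process up to time `s`. -/
abbrev pastSigma (B : ℝ≥0 → Ω → ℝ) (s : ℝ≥0) : MeasurableSpace Ω :=
  MeasurableSpace.comap (fun ω (t : Set.Iic s) => B t ω) inferInstance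

lemma measurable_pastSigma (B : ℝ≥0 → Ω → ℝ) {r s : ℝ≥0} (h : r ≤ s) :
    Measurable[pastSigma B s] (B r) :=
  (measurable_pi_apply (X := fun _ : Set.Iic s => ℝ) ⟨r, h⟩).comp
    (comap_measurable (fun ω (t : Set.Iic s) => B t ω))

lemma integrated_congr {B B' : ℝ≥0 → Ω → ℝ} {ω : Ω} (h : ∀ t, B t ω = B' t ω) (k : ℕ) (t : ℝ≥0) :
    integrated B k t ω = integrated B' k t ω := by
  induction k generalizing t with
  | zero => exact h t
  | succ k ih => rw [integrated_succ, integrated_succ]; simp_rw [ih]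

lemma W_congr {B B' : ℝ≥0 → Ω → ℝ} {ω : Ω} (h : ∀ t, B t ω = B' t ω) (n : ℕ) (t : ℝ≥0) :
    W B n t ω = W B' n t ω :=
  funext fun k => integrated_congr h k t

lemma X_eq_T_mulVec_W (B : ℝ≥0 → Ω → ℝ) (n : ℕ) (s : ℝ) (ω : Ω) :
    X B n s ω = T n (Real.exp s).toNNReal *ᵥ W B n (Real.exp s).toNNReal ω := by
  ext k
  rw [T, Matrix.mulVec_diagonal, Real.coe_toNNReal _ (Real.exp_pos s).le, ← Real.exp_mul, X, W,
    mul_comm s]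

end Paths

/-! ### Independence of the restarted process, and conditional laws. -/

section Independence

variable {Ω : Type*} [MeasurableSpace Ω] {P : Measure Ω} {B : ℝ≥0 → Ω → ℝ}

lemma IsRegularBrownian.shift (hB : IsRegularBrownian B P) (s : ℝ≥0) :
    IsRegularBrownian (fun u ω => B (s + u) ω - B s ω) P where
  toIsPreBrownianReal := hB.toIsPreBrownianReal.shift s
  measurable t := (hB.measurable _).sub (hB.measurable _)
  continuous ω := by
    have := hB.continuous ω
    fun_prop
  zero ω := by simp

lemma IsRegularBrownian.measurable_W_pastSigma (hB : IsRegularBrownian B P) (n : ℕ) {r s : ℝ≥0}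
    (h : r ≤ s) : Measurable[pastSigma B s] (W B n r) :=
  @IntegratedBrownian.measurable_W Ω (pastSigma B s) B hB.continuous s
    (fun _ hr => measurable_pastSigma B hr) n r h

lemma IsRegularBrownian.measurable_past_W (hB : IsRegularBrownian B P) (n : ℕ) (s : ℝ≥0) :
    Measurable[pastSigma B s] (past (W B n) s) :=
  @measurable_pi_lambda Ω _ _ (pastSigma B s) _ _ fun r => hB.measurable_W_pastSigma n r.2

lemma IsRegularBrownian.indep_shift_W (hB : IsRegularBrownian B P) (n : ℕ) (s t : ℝ≥0) :
    Indep (MeasurableSpace.comap (W (fun u ω => B (s + u) ω - B s ω) n t) inferInstance)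
      (pastSigma B s) P := by
  refine indep_of_indep_of_le_left (hB.indepFun_shift s) ?_
  refine Measurable.comap_le ?_
  refine @IntegratedBrownian.measurable_W Ω (MeasurableSpace.comap
    (fun ω (t : ℝ≥0) => B (s + t) ω - B s ω) inferInstance) _ (hB.shift s).continuous t
    (fun r _ => ?_) n t le_rfl
  exact (measurable_pi_apply (X := fun _ : ℝ≥0 => ℝ) r).comp
    (comap_measurable (fun ω (t : ℝ≥0) => B (s + t) ω - B s ω))

/-- By independence the joint law of `Y` and `f(Y) + Z` disintegrates over `Y` into the kernel `y ↦
law of f(y) + Z`, and disintegrations are almost surely unique. -/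
lemma condDistrib_add_of_indepFun [IsFiniteMeasure P] {β : Type*} [MeasurableSpace β] {n : ℕ}
    {Y : Ω → β} {Z : Ω → State n} (hY : Measurable Y) (hZ : Measurable Z) (hYZ : IndepFun Y Z P)
    {f : β → State n} (hf : Measurable f) :
    ∀ᵐ y ∂(P.map Y), condDistrib (fun ω => f (Y ω) + Z ω) Y P y =
      P.map (fun ω => f y + Z ω) := by
  have hg : Measurable fun q : β × State n => f q.1 + q.2 := by fun_prop
  let κ : Kernel β (State n) := (Kernel.id ×ₖ Kernel.const β (P.map Z)).map fun q => f q.1 + q.2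
  have hκ : ∀ y, κ y = P.map (fun ω => f y + Z ω) := by
    intro y
    simp only [κ]
    rw [Kernel.map_apply _ hg, Kernel.prod_apply, Kernel.id_apply, Kernel.const_apply,
      Measure.dirac_prod, Measure.map_map hg (by fun_prop), Measure.map_map (by fun_prop) hZ]
    rfl
  have hS : Measurable fun q : β × State n => (q.1, f q.1 + q.2) := by fun_prop
  have key : P.map (fun ω => (Y ω, f (Y ω) + Z ω)) = P.map Y ⊗ₘ κ := by
    have h1 : P.map (fun ω => (Y ω, f (Y ω) + Z ω)) =
        ((P.map Y).prod (P.map Z)).map fun q => (q.1, f q.1 + q.2) := by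
      rw [← (indepFun_iff_map_prod_eq_prod_map_map hY.aemeasurable hZ.aemeasurable).1 hYZ,
        Measure.map_map hS (hY.prodMk hZ)]
      rfl
    ext S hSm
    rw [h1, Measure.map_apply hS hSm, Measure.prod_apply (hS hSm), Measure.compProd_apply hSm]
    refine lintegral_congr fun y => ?_
    rw [hκ, Measure.map_apply hZ (measurable_prodMk_left (hS hSm)),
      Measure.map_apply (by fun_prop) (measurable_prodMk_left hSm)]
    rfl
  have hfin : IsFiniteKernel κ := inferInstance
  filter_upwards [condDistrib_ae_eq_of_measure_eq_compProd_of_measurable hY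
    ((hf.comp hY).add hZ) key] with y hy
  rw [← hκ y, ← hy]
  rfl

/-- The conditioning variable `Y` is kept abstract to serve twice: `Y = W(s)` for the transition
density and `Y` the whole past for the Markov property. -/
lemma ae_condDistrib_W (hB : IsRegularBrownian B P) [IsFiniteMeasure P] (n : ℕ) (s : ℝ≥0)
    {t : ℝ≥0} (ht : 0 < t) {β : Type*} [MeasurableSpace β] {Y : Ω → β}
    (hm : Measurable Y) (hY : Measurable[pastSigma B s] Y) {e : β → State n} (he : Measurable e)
    (hYe : ∀ ω, e (Y ω) = W B n s ω) :
    ∀ᵐ y ∂(P.map Y), condDistrib (W B n (s + t)) Y P y =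
      withLebesgueDensity (transitionDensity n t (e y)) := by
  have hZ := (hB.shift s).measurable_W n t
  have hind : IndepFun Y (W (fun u ω => B (s + u) ω - B s ω) n t) P :=
    (indep_of_indep_of_le_right (hB.indep_shift_W n s t) hY.comap_le).symm
  have hf : Measurable fun y => drift n t *ᵥ e y := by fun_prop
  have hW : W B n (s + t) = fun ω => drift n t *ᵥ e (Y ω) +
      W (fun u ω => B (s + u) ω - B s ω) n t ω := by
    ext1 ω
    rw [hYe, W_add (hB.continuous ω) n s ht]
  rw [hW]
  filter_upwards [condDistrib_add_of_indepFun hm hZ hind hf] with y hy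
  rw [hy, map_drift_add_W (hB.shift s) n ht]

lemma iIndepFun_modified_increments (hB : IsRegularBrownian B P) (n : ℕ) {N : ℕ}
    {t : Fin (N + 1) → ℝ≥0} (ht : StrictMono t) :
    iIndepFun (fun (i : Fin N) (ω : Ω) => W B n (t i.succ) ω -
      drift n ((t i.succ : ℝ) - (t i.castSucc : ℝ)) *ᵥ W B n (t i.castSucc) ω) P := by
  have hP : IsProbabilityMeasure P := hB.isGaussianProcess.isProbabilityMeasure
  have hlt : ∀ i : Fin N, t i.castSucc < t i.succ := fun i => ht i.castSucc_lt_succ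
  have hpast : ∀ (i : Fin N) (s : ℝ≥0), t i.succ ≤ s → Measurable[pastSigma B s] (fun ω : Ω =>
      W B n (t i.succ) ω - drift n ((t i.succ : ℝ) - (t i.castSucc : ℝ)) *ᵥ
        W B n (t i.castSucc) ω) := by
    intro i s hs
    have hM : Measurable fun q : State n × State n =>
        q.1 - drift n ((t i.succ : ℝ) - (t i.castSucc : ℝ)) *ᵥ q.2 := by fun_prop
    have haux : ∀ (m : MeasurableSpace Ω) (f g : Ω → State n), Measurable[m] f → Measurable[m] g →
        Measurable[m] fun ω =>
          f ω - drift n ((t i.succ : ℝ) - (t i.castSucc : ℝ)) *ᵥ g ω :=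
      fun m f g hf hg => hM.comp (hf.prodMk hg)
    exact haux _ _ _ (hB.measurable_W_pastSigma n hs)
      (hB.measurable_W_pastSigma n ((hlt i).le.trans hs))
  -- Each modified increment is the process restarted at the left endpoint, hence independent of the
  -- past there.
  have hfut : ∀ i : Fin N, (fun ω : Ω => W B n (t i.succ) ω -
      drift n ((t i.succ : ℝ) - (t i.castSucc : ℝ)) *ᵥ W B n (t i.castSucc) ω) =
      W (fun u ω => B (t i.castSucc + u) ω - B (t i.castSucc) ω) n
        (t i.succ - t i.castSucc) := by
    intro i
    ext1 ω
    have h := W_add (hB.continuous ω) n (t i.castSucc) (tsub_pos_of_lt (hlt i))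
    rw [add_tsub_cancel_of_le (hlt i).le, NNReal.coe_sub (hlt i).le] at h
    rw [h, add_sub_cancel_left]
  rw [iIndepFun_iff]
  intro S
  -- The latest increment is split off; all earlier ones are events of the past at its left
  -- endpoint.
  induction S using Finset.induction_on_max with
  | empty => simp
  | insert a S ha ih =>
    intro f hf
    have haS : a ∉ S := fun h => lt_irrefl a (ha a h)
    rw [Finset.set_biInter_insert, Finset.prod_insert haS,
      ← ih fun i hi => hf i (Finset.mem_insert_of_mem hi)]
    refine (Indep_iff _ _ P).1 (hB.indep_shift_W n (t a.castSucc) (t a.succ - t a.castSucc)) _ _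
      ?_ ?_
    · rw [← hfut a]
      exact hf a (Finset.mem_insert_self a S)
    · refine @Finset.measurableSet_biInter _ _ (pastSigma B (t a.castSucc)) f S fun i hi => ?_
      exact (hpast i (t a.castSucc) (ht.monotone (Fin.succ_le_castSucc_iff.2 (ha i hi)))).comap_le _
        (hf i (Finset.mem_insert_of_mem hi))

end Independence

/-! ### Passage to a version with regular paths. -/

section Modification

variable {Ω : Type*} [MeasurableSpace Ω] {P : Measure Ω} {B : ℝ≥0 → Ω → ℝ}

/-- A Brownian motion agrees, outside of a null set, with one whose values are measurable and whose
paths are all continuous and start at `0`. -/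
lemma exists_isRegularBrownian (hB : IsBrownianReal B P) :
    ∃ B' : ℝ≥0 → Ω → ℝ, IsRegularBrownian B' P ∧ ∀ᵐ ω ∂P, ∀ t, B t ω = B' t ω := by
  have hm := hB.toIsPreBrownianReal.aemeasurable
  have hall : ∀ᵐ ω ∂P, (Continuous fun t => B t ω) ∧ B 0 ω = 0 ∧
      ∀ k : ℕ, B (TopologicalSpace.denseSeq ℝ≥0 k) ω =
        (hm (TopologicalSpace.denseSeq ℝ≥0 k)).mk _ ω := by
    filter_upwards [hB.cont, hB.toIsPreBrownianReal.eval_zero_ae_eq_zero,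
      ae_all_iff.2 fun k => (hm (TopologicalSpace.denseSeq ℝ≥0 k)).ae_eq_mk] with ω h1 h2 h3
    exact ⟨h1, h2, h3⟩
  obtain ⟨G, hG, hGm, hGp⟩ := hall.exists_measurable_mem
  have hae : ∀ᵐ ω ∂P, ∀ t, B t ω = G.indicator (B t) ω := by
    filter_upwards [hG] with ω hω t
    rw [Set.indicator_of_mem hω]
  have hcont : ∀ ω, Continuous fun t => G.indicator (B t) ω := by
    intro ω
    by_cases hω : ω ∈ G
    · simpa [Set.indicator_of_mem hω] using (hGp ω hω).1
    · simpa [Set.indicator_of_notMem hω] using continuous_const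
  refine ⟨fun t => G.indicator (B t), ⟨?_, ?_, hcont, ?_⟩, hae⟩
  · exact hB.toIsPreBrownianReal.congr fun t => hae.mono fun ω h => h t
  · intro t
    obtain ⟨u, hu, hut⟩ := mem_closure_iff_seq_limit.1
      ((TopologicalSpace.denseRange_denseSeq ℝ≥0) t)
    refine measurable_of_tendsto_metrizable (f := fun k => G.indicator (B (u k))) (fun k => ?_)
      (tendsto_pi_nhds.2 fun ω => ((hcont ω).tendsto t).comp hut)
    obtain ⟨l, hl⟩ := hu k
    have : G.indicator (B (u k)) = G.indicator ((hm (TopologicalSpace.denseSeq ℝ≥0 l)).mk _) :=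
      Set.indicator_congr fun ω hω => by rw [← hl]; exact (hGp ω hω).2.2 l
    rw [this]
    exact (hm _).measurable_mk.indicator hGm
  · intro ω
    by_cases hω : ω ∈ G
    · simpa [Set.indicator_of_mem hω] using (hGp ω hω).2.1
    · simp [Set.indicator_of_notMem hω]

end Modification

/-! ### The transition density: explicit form, Markov property, uniqueness. -/

section Transition

variable {Ω : Type*} [MeasurableSpace Ω] {P : Measure Ω} {B B' : ℝ≥0 → Ω → ℝ}

lemma transitionDensity_nonneg (n : ℕ) {t : ℝ≥0} (ht : 0 < t) (a w : State n) :
    0 ≤ transitionDensity n t a w :=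
  (mul_pos (det_T_pos n (NNReal.coe_pos.2 ht)) (stationaryDensity_pos n _)).le

lemma transitionDensity_pos (n : ℕ) {t : ℝ≥0} (ht : 0 < t) (a w : State n) :
    0 < transitionDensity n t a w :=
  mul_pos (det_T_pos n (NNReal.coe_pos.2 ht)) (stationaryDensity_pos n _)

lemma continuous_transitionDensity (n : ℕ) (t : ℝ≥0) :
    Continuous fun q : State n × State n => transitionDensity n t q.1 q.2 :=
  continuous_const.mul ((continuous_stationaryDensity n).comp (by fun_prop))

lemma transitionDensity_eq (n : ℕ) {t : ℝ≥0} (ht : 0 < t) (a w : State n) :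
    transitionDensity n t a w = (t : ℝ) ^ (-(((n : ℝ) + 1) ^ 2 / 2)) * K n *
      Real.exp (-(1 / 2) * (residual n t a w ⬝ᵥ (Λ n *ᵥ residual n t a w))) := by
  rw [transitionDensity, det_T n (NNReal.coe_pos.2 ht), stationaryDensity, ← residual_eq, mul_assoc]

variable [IsFiniteMeasure P]

lemma isTransitionDensity_W (hB : IsRegularBrownian B' P) (h : ∀ᵐ ω ∂P, ∀ t, B t ω = B' t ω)
    (n : ℕ) : IsTransitionDensity (W B n) P (transitionDensity n) := by
  have hW : ∀ t, W B n t =ᵐ[P] W B' n t := fun t => h.mono fun ω hω => W_congr hω n t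
  refine ⟨fun t => (hB.measurable_W n t).aemeasurable.congr (hW t).symm,
    fun t _ => (continuous_transitionDensity n t).measurable,
    fun t ht => transitionDensity_nonneg n ht, fun s t ht => ?_⟩
  rw [condDistrib_congr (hW _) (hW _), Measure.map_congr (hW s)]
  exact ae_condDistrib_W hB n s ht (hB.measurable_W n s) (hB.measurable_W_pastSigma n le_rfl)
    measurable_id fun _ => rfl

lemma isMarkovWithDensity_W (hB : IsRegularBrownian B' P) (h : ∀ᵐ ω ∂P, ∀ t, B t ω = B' t ω)
    (n : ℕ) : IsMarkovWithDensity (W B n) P (transitionDensity n) := by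
  have hW : ∀ t, W B n t =ᵐ[P] W B' n t := fun t => h.mono fun ω hω => W_congr hω n t
  have hp : ∀ s, past (W B n) s =ᵐ[P] past (W B' n) s := fun s =>
    h.mono fun ω hω => funext fun r => W_congr hω n r
  have hm : ∀ s, Measurable (past (W B' n) s) := fun s =>
    measurable_pi_lambda _ fun r => hB.measurable_W n r
  refine ⟨fun s => (hm s).aemeasurable.congr (hp s).symm, fun s t ht => ?_⟩
  rw [condDistrib_congr (hW _) (hp _), Measure.map_congr (hp s)]
  exact ae_condDistrib_W hB n s ht (hm s) (hB.measurable_past_W n s)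
    (measurable_pi_apply _) fun _ => rfl

/-- Continuous densities of the same measure are equal. -/
lemma eq_of_withLebesgueDensity_eq {n : ℕ} {f g : State n → ℝ} (hf : Continuous f)
    (hg : Continuous g) (hf0 : ∀ w, 0 ≤ f w) (hg0 : ∀ w, 0 ≤ g w)
    (h : withLebesgueDensity f = withLebesgueDensity g) : f = g := by
  have hm : ∀ {u : State n → ℝ}, Continuous u → AEMeasurable (fun w => ENNReal.ofReal (u w)) :=
    fun hu => (ENNReal.continuous_ofReal.comp hu).measurable.aemeasurable
  have hae := (withDensity_eq_iff_of_sigmaFinite (hm hf) (hm hg)).1 h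
  refine (Continuous.ae_eq_iff_eq volume hf hg).1 (hae.mono fun w hw => ?_)
  exact (ENNReal.ofReal_eq_ofReal_iff (hf0 w) (hg0 w)).1 hw

lemma ae_of_ae_withLebesgueDensity {n : ℕ} {q : State n → ℝ} (hq : Measurable q)
    (hq0 : ∀ x, 0 < q x) {p : State n → Prop} (h : ∀ᵐ x ∂(withLebesgueDensity q), p x) :
    ∀ᵐ x, p x := by
  have hq' : Measurable fun x => ENNReal.ofReal (q x) := ENNReal.measurable_ofReal.comp hq
  rw [withLebesgueDensity, ae_withDensity_iff hq'] at h
  exact h.mono fun x hx => hx (ENNReal.ofReal_pos.2 (hq0 x)).ne'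

/-- The starting time `1` is taken because `W(0)` is almost surely `0` and tests only `a = 0`, while
the law of `W(1)` has a positive density. Continuity in `w` and then in `a` removes the exceptional
sets. -/
lemma IsTransitionDensity.eq_transitionDensity (hB : IsRegularBrownian B' P)
    (h : ∀ᵐ ω ∂P, ∀ t, B t ω = B' t ω) {n : ℕ} {π' : ℝ≥0 → State n → State n → ℝ}
    (hπ' : IsTransitionDensity (W B n) P π')
    (hc : ∀ t, 0 < t → Continuous fun q : State n × State n => π' t q.1 q.2)
    {t : ℝ≥0} (ht : 0 < t) (a w : State n) : π' t a w = transitionDensity n t a w := by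
  have hW : W B n 1 =ᵐ[P] W B' n 1 := h.mono fun ω hω => W_congr hω n 1
  have hlaw : P.map (W B n 1) = withLebesgueDensity (transitionDensity n 1 0) := by
    rw [Measure.map_congr hW, ← map_drift_add_W hB n one_pos 0]
    simp
  have hright : ∀ {ψ : State n → State n → ℝ}, (Continuous fun q : State n × State n => ψ q.1 q.2) →
      ∀ b, Continuous (ψ b) := fun hψ b => hψ.comp (by fun_prop : Continuous fun v => (b, v))
  have hleft : ∀ {ψ : State n → State n → ℝ}, (Continuous fun q : State n × State n => ψ q.1 q.2) →
      ∀ v, Continuous fun b => ψ b v := fun hψ v => hψ.comp (by fun_prop : Continuous fun b => (b, v))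
  have hcπ := continuous_transitionDensity n
  have hae : ∀ᵐ b ∂(P.map (W B n 1)), π' t b = transitionDensity n t b := by
    filter_upwards [hπ'.condDistrib_eq 1 t ht,
      (isTransitionDensity_W hB h n).condDistrib_eq 1 t ht] with b h1 h2
    exact eq_of_withLebesgueDensity_eq (hright (hc t ht) b) (hright (hcπ t) b) (hπ'.nonneg t ht b)
      (transitionDensity_nonneg n ht b) (h1.symm.trans h2)
  rw [hlaw] at hae
  have hae' := ae_of_ae_withLebesgueDensity (hright (hcπ 1) 0).measurable
    (transitionDensity_pos n one_pos 0) hae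
  have hfun : (fun b => π' t b w) = fun b => transitionDensity n t b w :=
    (Continuous.ae_eq_iff_eq volume (hleft (hc t ht) w) (hleft (hcπ t) w)).1
      (hae'.mono fun b hb => congrFun hb w)
  exact congrFun hfun a

end Transition

end IntegratedBrownian

/-! ### The theorem, transferred from the regular version to `B`. -/

theorem proposition5p2 {Ω : Type*} [MeasurableSpace Ω] (P : Measure Ω) [IsProbabilityMeasure P]
    (B : ℝ≥0 → Ω → ℝ) (hB : IsBrownianReal B P) (n : ℕ) :
    ∃ π : ℝ≥0 → IntegratedBrownian.State n → IntegratedBrownian.State n → ℝ,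
      -- `π` is the transition density of the Markov process `W`, continuous in `(a, w)` ...
      IntegratedBrownian.IsTransitionDensity (IntegratedBrownian.W B n) P π ∧
      IntegratedBrownian.IsMarkovWithDensity (IntegratedBrownian.W B n) P π ∧
      (∀ t, 0 < t → Continuous fun q : IntegratedBrownian.State n × IntegratedBrownian.State n =>
        π t q.1 q.2) ∧
      -- ... and it is the only continuous one.
      (∀ π' : ℝ≥0 → IntegratedBrownian.State n → IntegratedBrownian.State n → ℝ,
        IntegratedBrownian.IsTransitionDensity (IntegratedBrownian.W B n) P π' →
        (∀ t, 0 < t → Continuous fun q : IntegratedBrownian.State n × IntegratedBrownian.State n =>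
          π' t q.1 q.2) →
        ∀ t, 0 < t → ∀ a w, π' t a w = π t a w) ∧
      -- Expression through the continuous density `p` of `X(s)`, the same for every real `s`.
      (∃ p : IntegratedBrownian.State n → ℝ, Continuous p ∧ (∀ x, 0 ≤ p x) ∧
        (∀ s : ℝ, HasLaw (IntegratedBrownian.X B n s)
          (IntegratedBrownian.withLebesgueDensity p) P) ∧
        ∀ t, 0 < t → ∀ a w, π t a w = (t : ℝ) ^ (-(((n : ℝ) + 1) ^ 2 / 2)) *
          p (IntegratedBrownian.T n t *ᵥ w -
            (IntegratedBrownian.Γ n * IntegratedBrownian.T n t) *ᵥ a)) ∧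
      -- The explicit formula.
      (∀ t, 0 < t → ∀ a w, π t a w =
        (t : ℝ) ^ (-(((n : ℝ) + 1) ^ 2 / 2)) * IntegratedBrownian.K n *
          Real.exp (-(1 / 2) * (IntegratedBrownian.residual n t a w ⬝ᵥ
            (IntegratedBrownian.Λ n *ᵥ IntegratedBrownian.residual n t a w)))) ∧
      -- The symmetry.
      (∀ t, 0 < t → ∀ a w, π t a w =
        π t (IntegratedBrownian.starVec w) (IntegratedBrownian.starVec a)) ∧
      -- The modified increments are independent.
      (∀ (N : ℕ) (t : Fin (N + 1) → ℝ≥0), StrictMono t →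
        iIndepFun (fun (i : Fin N) (ω : Ω) =>
          IntegratedBrownian.W B n (t i.succ) ω -
            IntegratedBrownian.drift n ((t i.succ : ℝ) - (t i.castSucc : ℝ)) *ᵥ
              IntegratedBrownian.W B n (t i.castSucc) ω) P) := by
  obtain ⟨B', hB', h⟩ := IntegratedBrownian.exists_isRegularBrownian hB
  refine ⟨IntegratedBrownian.transitionDensity n, IntegratedBrownian.isTransitionDensity_W hB' h n,
    IntegratedBrownian.isMarkovWithDensity_W hB' h n,
    fun t _ => IntegratedBrownian.continuous_transitionDensity n t,
    fun π' hπ' hc t ht a w => hπ'.eq_transitionDensity hB' h hc ht a w,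
    ⟨IntegratedBrownian.stationaryDensity n, IntegratedBrownian.continuous_stationaryDensity n,
      fun x => (IntegratedBrownian.stationaryDensity_pos n x).le, fun s => ?_, fun t ht a w => ?_⟩,
    fun t ht a w => IntegratedBrownian.transitionDensity_eq n ht a w, fun t ht a w => ?_,
    fun N t ht => ?_⟩
  -- `X(s) = T(e^s) W(e^s)`, and the law of `T(t) W(t)` does not depend on `t > 0`.
  · refine (IntegratedBrownian.hasLaw_T_mulVec_W hB' n
      (Real.toNNReal_pos.2 (Real.exp_pos s))).congr (h.mono fun ω hω => ?_)
    rw [IntegratedBrownian.X_eq_T_mulVec_W, IntegratedBrownian.W_congr hω]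
  · rw [IntegratedBrownian.transitionDensity, IntegratedBrownian.det_T n (NNReal.coe_pos.2 ht)]
  · rw [IntegratedBrownian.transitionDensity_eq n ht, IntegratedBrownian.transitionDensity_eq n ht,
      IntegratedBrownian.residual_quadratic_star]
  · refine (iIndepFun_congr fun i => ?_).2
      (IntegratedBrownian.iIndepFun_modified_increments hB' n ht)
    filter_upwards [h] with ω hω
    rw [IntegratedBrownian.W_congr hω, IntegratedBrownian.W_congr hω]
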